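/- Let $2A_1=A_1\oplus A_1$ be the lattice $\mathbb Z^2$ with the bilinear form $(x,y)=2x_1y_1+2x_2y_2$, with dual lattice $(2A_1)^\vee$ and full integral orthogonal group $O(2A_1)$. For $k,m\in\mathbb Z$ a weak Jacobi form of weight $k$ and index $m$ for $2A_1$ is a holomorphic function $\varphi:\mathcal H\times\mathbb C^2\to\mathbb C$ such that $$\varphi\Big(\tfrac{a\tau+b}{c\tau+d},\tfrac{\mathfrak z}{c\tau+d}\Big)=(c\tau+d)^k e^{\pi i m\frac{c(\mathfrak z,\mathfrak z)}{c\tau+d}}\varphi(\tau,\mathfrak z)\quad\text{for all }\begin{pmatrix}a&b\\c&d\end{pmatrix}\in SL_2(\mathbb Z),$$ $$\varphi(\tau,\mathfrak z+\lambda\tau+\mu)=e^{-2\pi i m(\lambda,\mathfrak z)-\pi i m(\lambda,\lambda)\tau}\varphi(\tau,\mathfrak z)\quad\text{for all }\lambda,\mu\in 2A_1,$$ and such that $\varphi$ has a Fourier expansion $\varphi(\tau,\mathfrak z)=\sum_{n\ge 0,\ l\in (2A_1)^\vee}a(n,l)\,e^{2\pi i n\tau}e^{2\pi i(\mathfrak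 z,l)}$. Let $J^{w,O}_{k,m}(2A_1)$ be the space of those forms which satisfy $\varphi(\tau,g\mathfrak z)=\varphi(\tau,\mathfrak z)$ for all $g\in O(2A_1)$, and let $$J^{w,O}_{*,*}(2A_1)=\bigoplus_{k\in\mathbb Z,\ m\in\mathbb Z_{\ge0}}J^{w,O}_{k,m}(2A_1)$$ be the bigraded ring of $O(2A_1)$-invariant weak Jacobi forms. It is an algebra over the graded ring $M_*$ of holomorphic modular forms for $SL_2(\mathbb Z)$, a modular form of weight $k$ being a Jacobi form of weight $k$ and index $0$. For $\tau\in\mathcal H$, $z\in\mathbb C$, and with $q^r=e^{2\pi i r\tau}$, $\zeta^r=e^{2\pi i rz}$, put $$\vartheta(\tau,z)=q^{1/8}\sum_{n\in\mathbb Z}(-1)^nq^{n(n+1)/2}\zeta^{n+1/2},\qquad \eta(\tau)=q^{1/24}\prod_{n\ge1}(1-q^n),$$ $$\varphi_{-2,1}(\tau,z)=\frac{\vartheta(\tau,z)^2}{\eta(\tau)^6},\qquad \varphi_{0,1}(\tau,z)=-\frac{3}{\pi^2}\,\wp(\tau,z)\,\varphi_{-2,1}(\tau,z),$$ where $\wp(\tau,\cdot)$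 is the Weierstrass function of the lattice $\mathbb Z+\mathbb Z\tau$, and the removable singularities of $\varphi_{0,1}(\tau,\cdot)$ at the points of this lattice are removed. Then the functions $$\varphi^{2A_1}_{0,1}=\varphi_{0,1}(\tau,z_1)\varphi_{0,1}(\tau,z_2),$$ $$\varphi^{2A_1}_{-2,1}=\varphi_{-2,1}(\tau,z_1)\varphi_{0,1}(\tau,z_2)+\varphi_{0,1}(\tau,z_1)\varphi_{-2,1}(\tau,z_2),$$ $$\varphi^{2A_1}_{-4,1}=\varphi_{-2,1}(\tau,z_1)\varphi_{-2,1}(\tau,z_2)$$ are $O(2A_1)$-invariant weak Jacobi forms of index $1$ and of weights $0$, $-2$, $-4$ respectively. They are algebraically independent over $M_*$ and generate $J^{w,O}_{*,*}(2A_1)$ as an $M_*$-algebra, so that $$J^{w,O}_{*,*}(2A_1)=M_*[\varphi^{2A_1}_{0,1},\varphi^{2A_1}_{-2,1},\varphi^{2A_1}_{-4,1}]$$ is a polynomial ring over $M_*$ in these three generators. -/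

import Mathlib

noncomputable section

namespace WeakJacobi

open Complex
open UpperHalfPlane (ofComplex)
open scoped Topology Real MatrixGroups DirectSum UpperHalfPlane

/-! ### Lattices -/

/-- The bilinear extension to `R ^ n` of the form on `ℤ ^ n` with Gram matrix `S`. -/
def gramForm {n : ℕ} (S : Matrix (Fin n) (Fin n) ℤ) {R : Type*} [CommRing R]
    (x y : Fin n → R) : R :=
  ∑ i, ∑ j, (S i j : R) * x i * y j

/-- A positive definite even lattice of rank `n` with a chosen basis: the underlying module is
`ℤ ^ n`, and the symmetric bilinear form is given by its Gram matrix. -/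
structure EvenLattice (n : ℕ) where
  /-- The Gram matrix. -/
  gram : Matrix (Fin n) (Fin n) ℤ
  symm : gram.IsSymm
  even : ∀ x : Fin n → ℤ, Even (gramForm gram x x)
  posDef : ∀ x : Fin n → ℤ, x ≠ 0 → 0 < gramForm gram x x

namespace EvenLattice

variable {n : ℕ} (L : EvenLattice n)

/-- The form `(x, y)` of the lattice, extended to `L ⊗ R = R ^ n`. -/
def form {R : Type*} [CommRing R] (x y : Fin n → R) : R := gramForm L.gram x y

/-- The dual lattice `L^∨`, inside `L ⊗ ℚ`. -/
def dual : AddSubgroup (Fin n → ℚ) where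
  carrier := {l | ∀ x : Fin n → ℤ, ∃ k : ℤ, L.form (fun i ↦ (x i : ℚ)) l = k}
  zero_mem' x := ⟨0, by simp [form, gramForm]⟩
  add_mem' {a b} ha hb x := by
    obtain ⟨k, hk⟩ := ha x
    obtain ⟨k', hk'⟩ := hb x
    refine ⟨k + k', ?_⟩
    rw [Int.cast_add, ← hk, ← hk']
    simp [form, gramForm, mul_add, Finset.sum_add_distrib]
  neg_mem' {a} ha x := by
    obtain ⟨k, hk⟩ := ha x
    refine ⟨-k, ?_⟩
    rw [Int.cast_neg, ← hk]
    simp [form, gramForm]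

/-- The full integral orthogonal group `O(L)`: the automorphisms of `ℤ ^ n` which preserve the
form of the lattice. -/
def orthogonalGroup : Subgroup ((Fin n → ℤ) ≃ₗ[ℤ] (Fin n → ℤ)) where
  carrier := {g | ∀ x y, L.form (g x) (g y) = L.form x y}
  one_mem' _ _ := rfl
  mul_mem' {g h} hg hh x y := (hg (h x) (h y)).trans (hh x y)
  inv_mem' {g} hg x y := by
    have h := hg (g⁻¹ x) (g⁻¹ y)
    have e : ∀ v, g (g⁻¹ v) = v := fun v ↦ g.apply_symm_apply v
    rw [e, e] at h
    exact h.symm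

end EvenLattice

/-- The `ℂ`-linear extension to `ℂ ^ n` of an automorphism of `ℤ ^ n`. -/
def complexify {n : ℕ} (g : (Fin n → ℤ) ≃ₗ[ℤ] (Fin n → ℤ)) (z : Fin n → ℂ) : Fin n → ℂ :=
  fun i ↦ ∑ j, (g (Pi.single j 1) i : ℂ) * z j

/-- The lattice `2A₁ = A₁ ⊕ A₁`, that is `ℤ ^ 2` with the form `2 x₁ y₁ + 2 x₂ y₂`. -/
def twoA1 : EvenLattice 2 where
  gram := Matrix.diagonal fun _ ↦ 2
  symm := Matrix.isSymm_diagonal _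
  even x := ⟨x 0 * x 0 + x 1 * x 1, by simp [gramForm, Fin.sum_univ_two]; ring⟩
  posDef x hx := by
    have h : x 0 ≠ 0 ∨ x 1 ≠ 0 := by
      by_contra! h
      exact hx (by ext i; fin_cases i <;> simp [h.1, h.2])
    simp only [gramForm, Fin.sum_univ_two, Matrix.diagonal_apply]
    rcases h with h | h <;> simp <;>
      nlinarith [mul_self_pos.mpr h, mul_self_nonneg (x 0), mul_self_nonneg (x 1)]

/-! ### Weak Jacobi forms -/

section Forms

variable {n : ℕ} (L : EvenLattice n)

/-- The index set of the Fourier expansion: the pairs `(N, l)` with `N ≥ 0` and `l ∈ L^∨`. -/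
abbrev FourierIndex : Type := ℕ × L.dual

/-- The monomial `q ^ N * ζ ^ l`, where `q = exp (2πiτ)` and `ζ ^ l = exp (2πi (z, l))`. -/
def fourierMonomial (p : FourierIndex L) (τ : ℍ) (z : Fin n → ℂ) : ℂ :=
  cexp (2 * π * I * p.1 * τ) * cexp (2 * π * I * L.form z (fun i ↦ ((p.2 : Fin n → ℚ) i : ℂ)))

/-- A weak Jacobi form of weight `k` and index `m` for the lattice `L`. -/
structure IsWeakJacobiForm (k m : ℤ) (φ : ℍ → (Fin n → ℂ) → ℂ) : Prop where
  /-- `φ` is holomorphic on `ℍ × (L ⊗ ℂ)`, jointly in all variables. -/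
  holomorphic : DifferentiableOn ℂ
    (fun p : ℂ × (Fin n → ℂ) ↦ φ (ofComplex p.1) p.2) {p | 0 < p.1.im}
  modular : ∀ (γ : SL(2, ℤ)) (τ : ℍ) (z : Fin n → ℂ),
    φ (γ • τ) (fun i ↦ z i / ((γ 1 0 : ℂ) * τ + (γ 1 1 : ℂ))) =
      ((γ 1 0 : ℂ) * τ + (γ 1 1 : ℂ)) ^ k *
        cexp (π * I * m * ((γ 1 0 : ℂ) * L.form z z / ((γ 1 0 : ℂ) * τ + (γ 1 1 : ℂ)))) * φ τ z
  elliptic : ∀ (l μ : Fin n → ℤ) (τ : ℍ) (z : Fin n → ℂ),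
    φ τ (fun i ↦ z i + l i * τ + μ i) =
      cexp (-2 * π * I * m * L.form (fun i ↦ (l i : ℂ)) z -
        π * I * m * L.form (fun i ↦ (l i : ℂ)) (fun i ↦ (l i : ℂ)) * τ) * φ τ z
  fourier : ∃ a : FourierIndex L → ℂ, ∀ (τ : ℍ) (z : Fin n → ℂ),
    HasSum (fun p ↦ a p * fourierMonomial L p τ z) (φ τ z)

variable {L}

lemma fourierMonomial_add (p p' : FourierIndex L) (τ : ℍ) (z : Fin n → ℂ) :
    fourierMonomial L (p + p') τ z = fourierMonomial L p τ z * fourierMonomial L p' τ z := by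
  have h : L.form z (fun i ↦ (((p + p').2 : Fin n → ℚ) i : ℂ)) =
      L.form z (fun i ↦ ((p.2 : Fin n → ℚ) i : ℂ)) +
        L.form z (fun i ↦ ((p'.2 : Fin n → ℚ) i : ℂ)) := by
    simp [EvenLattice.form, gramForm, mul_add, Finset.sum_add_distrib]
  simp only [fourierMonomial, h, ← Complex.exp_add]
  congr 1
  push_cast [Prod.fst_add]
  ring

lemma IsWeakJacobiForm.zero (k m : ℤ) : IsWeakJacobiForm L k m 0 where
  holomorphic := by simp
  modular := by simp
  elliptic := by simp
  fourier := ⟨0, by simp⟩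

lemma IsWeakJacobiForm.add {k m : ℤ} {φ ψ : ℍ → (Fin n → ℂ) → ℂ}
    (hφ : IsWeakJacobiForm L k m φ) (hψ : IsWeakJacobiForm L k m ψ) :
    IsWeakJacobiForm L k m (φ + ψ) where
  holomorphic := hφ.holomorphic.add hψ.holomorphic
  modular γ τ z := by
    simp only [Pi.add_apply, hφ.modular, hψ.modular]; ring
  elliptic l μ τ z := by
    simp only [Pi.add_apply, hφ.elliptic, hψ.elliptic]; ring
  fourier := by
    obtain ⟨a, ha⟩ := hφ.fourier
    obtain ⟨b, hb⟩ := hψ.fourier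
    exact ⟨a + b, fun τ z ↦ by simpa [add_mul] using (ha τ z).add (hb τ z)⟩

lemma IsWeakJacobiForm.smul {k m : ℤ} {φ : ℍ → (Fin n → ℂ) → ℂ} (c : ℂ)
    (hφ : IsWeakJacobiForm L k m φ) : IsWeakJacobiForm L k m (c • φ) where
  holomorphic := hφ.holomorphic.const_smul c
  modular γ τ z := by
    simp only [Pi.smul_apply, smul_eq_mul, hφ.modular]; ring
  elliptic l μ τ z := by
    simp only [Pi.smul_apply, smul_eq_mul, hφ.elliptic]; ring
  fourier := by
    obtain ⟨a, ha⟩ := hφ.fourier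
    exact ⟨c • a, fun τ z ↦ by simpa [mul_assoc] using (ha τ z).mul_left c⟩

lemma denom_cast_ne_zero (γ : SL(2, ℤ)) (τ : ℍ) : (γ 1 0 : ℂ) * τ + (γ 1 1 : ℂ) ≠ 0 := by
  have h := UpperHalfPlane.denom_ne_zero γ τ
  rwa [ModularGroup.denom_apply] at h

lemma IsWeakJacobiForm.mul {k k' m m' : ℤ} {φ ψ : ℍ → (Fin n → ℂ) → ℂ}
    (hφ : IsWeakJacobiForm L k m φ) (hψ : IsWeakJacobiForm L k' m' ψ) :
    IsWeakJacobiForm L (k + k') (m + m') (φ * ψ) where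
  holomorphic := hφ.holomorphic.mul hψ.holomorphic
  modular γ τ z := by
    simp only [Pi.mul_apply, hφ.modular, hψ.modular, zpow_add₀ (denom_cast_ne_zero γ τ)]
    rw [Int.cast_add, mul_add, add_mul, Complex.exp_add]
    ring
  elliptic l μ τ z := by
    simp only [Pi.mul_apply, hφ.elliptic, hψ.elliptic]
    rw [mul_mul_mul_comm, ← Complex.exp_add]
    congr 2
    push_cast
    ring
  fourier := by
    obtain ⟨a, ha⟩ := hφ.fourier
    obtain ⟨b, hb⟩ := hψ.fourier
    let s : FourierIndex L × FourierIndex L → FourierIndex L := fun x ↦ x.1 + x.2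
    refine ⟨fun p ↦ ∑' x : {x // s x = p}, a x.1.1 * b x.1.2, fun τ z ↦ ?_⟩
    have hsum := summable_mul_of_summable_norm (ha τ z).summable.norm (hb τ z).summable.norm
    have hprod := (ha τ z).mul (hb τ z) hsum
    have hσ := ((Equiv.sigmaFiberEquiv s).hasSum_iff).mpr hprod
    have hmain := hσ.sigma fun p ↦ (hσ.summable.sigma_factor p).hasSum
    refine (congrArg (fun u ↦ HasSum u (φ τ z * ψ τ z)) (funext fun p ↦ ?_)).mpr hmain
    rw [← tsum_mul_right]
    refine tsum_congr fun x ↦ ?_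
    have hx : x.1.1 + x.1.2 = p := x.2
    simp only [Function.comp, Equiv.sigmaFiberEquiv, Equiv.coe_fn_mk]
    have he := fourierMonomial_add x.1.1 x.1.2 τ z
    rw [hx] at he
    rw [he]
    ring

variable (L)

/-- A function on `ℍ × (L ⊗ ℂ)` is `O(L)`-invariant. -/
def IsOInvariant (φ : ℍ → (Fin n → ℂ) → ℂ) : Prop :=
  ∀ g ∈ L.orthogonalGroup, ∀ (τ : ℍ) (z : Fin n → ℂ), φ τ (complexify g z) = φ τ z

/-- The space `J_{k,m}^{w,O}(L)` of `O(L)`-invariant weak Jacobi forms of weight `k` and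
index `m`. The degrees are the pairs `(k, m)` with `k ∈ ℤ` and `m ≥ 0`. -/
def jacobiForms (p : ℤ × ℕ) : Submodule ℂ (ℍ → (Fin n → ℂ) → ℂ) where
  carrier := {φ | IsWeakJacobiForm L p.1 p.2 φ ∧ IsOInvariant L φ}
  zero_mem' := ⟨.zero _ _, fun _ _ _ _ ↦ rfl⟩
  add_mem' h h' := ⟨h.1.add h'.1, fun g hg τ z ↦ by
    simp only [Pi.add_apply, h.2 g hg, h'.2 g hg]⟩
  smul_mem' c _ h := ⟨h.1.smul c, fun g hg τ z ↦ by
    simp only [Pi.smul_apply, h.2 g hg]⟩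

/-! ### The bigraded ring and its structure as an algebra over the ring of modular forms -/

/-- The graded ring `M_*` of holomorphic modular forms for `SL₂(ℤ)`. -/
abbrev ModularFormRing : Type := ⨁ k : ℤ, ModularForm 𝒮ℒ k

/-- A modular form of weight `k`, as a function on `ℍ × (L ⊗ ℂ)`, is an `O(L)`-invariant weak
Jacobi form of weight `k` and index `0`. -/
lemma modularForm_mem_jacobiForms {k : ℤ} (f : ModularForm 𝒮ℒ k) :
    (fun (τ : ℍ) (_ : Fin n → ℂ) ↦ f τ) ∈ jacobiForms L (k, 0) := by
  refine ⟨⟨?_, ?_, ?_, ?_⟩, fun _ _ _ _ ↦ rfl⟩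
  · have h := UpperHalfPlane.mdifferentiable_iff.mp f.holo'
    exact h.comp differentiableOn_fst fun p hp ↦ hp
  · intro γ τ z
    have h := SlashInvariantForm.slash_action_eqn'' f
      (γ := Matrix.SpecialLinearGroup.mapGL ℝ γ) (MonoidHom.mem_range.mpr ⟨γ, rfl⟩) τ
    have hd : UpperHalfPlane.denom (Matrix.SpecialLinearGroup.mapGL ℝ γ) τ =
        (γ 1 0 : ℂ) * τ + (γ 1 1 : ℂ) := by simp [UpperHalfPlane.denom]
    rw [hd] at h
    simp only [Nat.cast_zero, Int.cast_zero, mul_zero, zero_mul, Complex.exp_zero, mul_one]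
    exact h
  · simp
  · classical
    refine ⟨fun p ↦ if p.2 = 0 then (UpperHalfPlane.qExpansion 1 f).coeff p.1 else 0,
      fun τ z ↦ ?_⟩
    have h := ModularForm.hasSum_qExpansion f one_pos
      one_mem_strictPeriods_SL τ
    have hinj : Function.Injective (fun N : ℕ ↦ ((N, 0) : FourierIndex L)) :=
      fun a b hab ↦ (Prod.mk.inj hab).1
    refine (hinj.hasSum_iff ?_).mp ?_
    · rintro ⟨N, l⟩ hl
      have : l ≠ 0 := by rintro rfl; exact hl ⟨N, rfl⟩
      simp [this]
    · convert h using 2 with N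
      simp [fourierMonomial, EvenLattice.form, gramForm, Function.Periodic.qParam,
        ← Complex.exp_nat_mul]
      left
      congr 1
      ring

instance : SetLike.GradedMonoid (jacobiForms L) where
  one_mem := modularForm_mem_jacobiForms L (1 : ModularForm 𝒮ℒ 0)
  mul_mem p p' φ ψ h h' := by
    refine ⟨?_, fun g hg τ z ↦ ?_⟩
    · simpa using h.1.mul h'.1
    · simp only [Pi.mul_apply, h.2 g hg, h'.2 g hg]

/-- The bigraded ring `J_{*,*}^{w,O}(L)`, the direct sum of the spaces of `O(L)`-invariant weak
Jacobi forms of weight `k ∈ ℤ` and index `m ≥ 0`, with the multiplication of functions. -/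
abbrev JacobiRing : Type := ⨁ p : ℤ × ℕ, jacobiForms L p

/-- The inclusion `M_k → J_{k,0}^{w,O}(L)`. -/
def modularFormInclusion (k : ℤ) : ModularForm 𝒮ℒ k →+ jacobiForms L (k, 0) where
  toFun f := ⟨fun τ _ ↦ f τ, modularForm_mem_jacobiForms L f⟩
  map_zero' := rfl
  map_add' _ _ := rfl

/-- A modular form of weight `k`, as an element of degree `(k, 0)` of the bigraded ring. -/
def modularFormOf (k : ℤ) : ModularForm 𝒮ℒ k →+ JacobiRing L :=
  (DirectSum.of (fun p ↦ jacobiForms L p) (k, 0)).comp (modularFormInclusion L k)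

lemma modularFormOf_one :
    modularFormOf L 0 (GradedMonoid.GOne.one : ModularForm 𝒮ℒ 0) = 1 := rfl

lemma modularFormOf_mul {k k' : ℤ} (f : ModularForm 𝒮ℒ k) (g : ModularForm 𝒮ℒ k') :
    modularFormOf L (k + k') (GradedMonoid.GMul.mul f g) =
      modularFormOf L k f * modularFormOf L k' g := by
  simp only [modularFormOf, AddMonoidHom.comp_apply]
  rw [DirectSum.of_mul_of]
  rfl

/-- The ring homomorphism `M_* → J_{*,*}^{w,O}(L)` sending a modular form to itself, as a Jacobi
form of index `0`. -/
def modularFormHom : ModularFormRing →+* JacobiRing L :=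
  DirectSum.toSemiring (modularFormOf L) (modularFormOf_one L) (modularFormOf_mul L)

lemma modularFormHom_of {k : ℤ} (f : ModularForm 𝒮ℒ k) :
    modularFormHom L (DirectSum.of (ModularForm 𝒮ℒ) k f) = modularFormOf L k f := by
  rw [modularFormHom, DirectSum.toSemiring_of]

instance : Algebra ModularFormRing (JacobiRing L) := (modularFormHom L).toAlgebra

end Forms

/-! ### The generators -/

/-- The odd Jacobi theta function
`ϑ(τ, z) = q^(1/8) ∑_{n ∈ ℤ} (-1)^n q^(n(n+1)/2) ζ^(n+1/2)`. -/
def theta (τ : ℍ) (z : ℂ) : ℂ :=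
  cexp (2 * π * I * τ / 8) * ∑' n : ℤ, (-1 : ℂ) ^ n *
    cexp (2 * π * I * (n * (n + 1) / 2) * τ) * cexp (2 * π * I * (n + 1 / 2) * z)

/-- `φ_{-2,1}(τ, z) = ϑ(τ, z)² / η(τ)⁶`. -/
def phiNeg2 (τ : ℍ) (z : ℂ) : ℂ := theta τ z ^ 2 / ModularForm.eta τ ^ 6

/-- The periods `1, τ`. -/
def periodPair (τ : ℍ) : PeriodPair where
  ω₁ := 1
  ω₂ := τ
  indep := by
    rw [LinearIndependent.pair_iff]
    intro s t h
    have him := congrArg Complex.im h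
    have hre := congrArg Complex.re h
    have ht : t = 0 := by simpa [τ.im_ne_zero] using him
    subst ht
    exact ⟨by simpa using hre, rfl⟩

/-- `φ_{0,1}(τ, z) = -(3 / π²) ℘(τ, z) φ_{-2,1}(τ, z)`, where `℘(τ, ·)` is the Weierstrass function
of the lattice `ℤ + ℤτ`. The product has removable singularities at the points of this lattice,
where its value is the limit. -/
def phiZero (τ : ℍ) (z : ℂ) : ℂ :=
  Filter.limUnder (𝓝[≠] z) fun w ↦ -(3 / (π : ℂ) ^ 2) * (periodPair τ).weierstrassP w * phiNeg2 τ w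

/-- `φ_{0,1}(τ, z₁) φ_{0,1}(τ, z₂)`, of weight `0` and index `1`. -/
def genZero (τ : ℍ) (z : Fin 2 → ℂ) : ℂ := phiZero τ (z 0) * phiZero τ (z 1)

/-- `φ_{-2,1}(τ, z₁) φ_{0,1}(τ, z₂) + φ_{0,1}(τ, z₁) φ_{-2,1}(τ, z₂)`, of weight `-2` and
index `1`. -/
def genNeg2 (τ : ℍ) (z : Fin 2 → ℂ) : ℂ :=
  phiNeg2 τ (z 0) * phiZero τ (z 1) + phiZero τ (z 0) * phiNeg2 τ (z 1)

/-- `φ_{-2,1}(τ, z₁) φ_{-2,1}(τ, z₂)`, of weight `-4` and index `1`. -/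
def genNeg4 (τ : ℍ) (z : Fin 2 → ℂ) : ℂ := phiNeg2 τ (z 0) * phiNeg2 τ (z 1)

/-- The three generators, as elements of the bigraded ring `J_{*,*}^{w,O}(2A₁)`. -/
def generators (h0 : genZero ∈ jacobiForms twoA1 (0, 1))
    (h2 : genNeg2 ∈ jacobiForms twoA1 (-2, 1)) (h4 : genNeg4 ∈ jacobiForms twoA1 (-4, 1)) :
    Fin 3 → JacobiRing twoA1 :=
  ![DirectSum.of (fun p ↦ jacobiForms twoA1 p) (0, 1) ⟨genZero, h0⟩,
    DirectSum.of (fun p ↦ jacobiForms twoA1 p) (-2, 1) ⟨genNeg2, h2⟩,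
    DirectSum.of (fun p ↦ jacobiForms twoA1 p) (-4, 1) ⟨genNeg4, h4⟩]

end WeakJacobi

end

/-!
Write `x = φ_{-2,1}` and `y = φ_{0,1}`. The proof reduces the statement on `2A₁` to the theory of
`x` and `y` in one elliptic variable, applied in each of the two variables.

*The functions `x` and `y`.* The theta series gives the quasi-periodicity of `ϑ` and its behaviour
under `τ ↦ τ + 1` and `τ ↦ -1 / τ`, hence the modularity of `x`; that of `y` follows from the
homogeneity of `℘`. The constant `ϑ'(τ, 0)² / η⁶` is a modular form of weight `0`, and its value at
`i∞` is `-4π²`; so `ϑ'(τ, 0) ≠ 0` and `y(τ, 0) = 12` (`deriv_theta_zero_sq`). The even entire functions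
with the quasi-periodicity of index `m` form a space of dimension at most `m + 1`, because their
Fourier coefficients satisfy a recursion (`mem_span_of_linearIndependent`). For `m = 1` this
gives `℘ ϑ² = ϑ'² - ϑ ϑ'' + c ϑ²` (`wpTheta_eq`), from which the Fourier expansion of `y` is read
off (`isWeak_phiZero`).

*Generation.* At a fixed `τ` the quotient `x / y` is not constant, so that the monomials
`x ^ i y ^ (m - i)` are a basis of the space of index `m`. A form `φ` of index `m` is therefore
`∑ f_ij(τ) (x ^ i y ^ (m - i))(z₁) (x ^ j y ^ (m - j))(z₂)` with unique coefficients. Uniqueness gives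
the transformation law of `f_ij` in weight `k + 2i + 2j` and the symmetry `f_ij = f_ji`; solving for the
`f_ij` from the values of `φ` at interpolation points, with a matrix of Vandermonde type, gives
holomorphy, and boundedness at `i∞`, where the points can be chosen so that the limit of the matrix is
invertible (`exists_modularForm_coefficients`). Symmetric combinations of the products of
monomials are polynomials in the three generators, by Newton's recursion for power sums
(`IsGenerated.symmetrized`).

*Independence.* A relation splits into its components of degree `(k, m)`. At a fixed `τ`, with
`s = (x / y)(z₁)` and `t = (x / y)(z₂)`, the generators are proportional to `(1, s + t, s t)`, and `s`
and `t` range over an infinite set; a homogeneous polynomial that vanishes at all these points is zero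
(`eq_zero_of_isHomogeneous`).
-/

noncomputable section

namespace WeakJacobi

open Complex Filter
open UpperHalfPlane (ofComplex)
open scoped Topology Real MatrixGroups DirectSum UpperHalfPlane

/-! ### Fourier expansions with non-negative powers of `q` -/

section Expansion

variable {ι X : Type*}

/-- `F` is the sum of an everywhere (hence absolutely) convergent series in the functions `e p`. -/
def HasExpansion (e : ι → X → ℂ) (F : X → ℂ) : Prop :=
  ∃ a : ι → ℂ, ∀ x, HasSum (fun p ↦ a p * e p x) (F x)

lemma HasExpansion.add {e : ι → X → ℂ} {F G : X → ℂ} (hF : HasExpansion e F)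
    (hG : HasExpansion e G) : HasExpansion e (fun x ↦ F x + G x) := by
  obtain ⟨a, ha⟩ := hF
  obtain ⟨b, hb⟩ := hG
  exact ⟨a + b, fun x ↦ by simpa [add_mul] using (ha x).add (hb x)⟩

lemma HasExpansion.const_mul {e : ι → X → ℂ} {F : X → ℂ} (c : ℂ) (hF : HasExpansion e F) :
    HasExpansion e (fun x ↦ c * F x) := by
  obtain ⟨a, ha⟩ := hF
  exact ⟨c • a, fun x ↦ by simpa [mul_assoc] using (ha x).mul_left c⟩

lemma HasExpansion.sub {e : ι → X → ℂ} {F G : X → ℂ} (hF : HasExpansion e F)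
    (hG : HasExpansion e G) : HasExpansion e (fun x ↦ F x - G x) := by
  simpa [sub_eq_add_neg] using hF.add (hG.const_mul (-1))

lemma HasExpansion.mul [Add ι] {e : ι → X → ℂ} (he : ∀ p p' x, e (p + p') x = e p x * e p' x)
    {F G : X → ℂ} (hF : HasExpansion e F) (hG : HasExpansion e G) :
    HasExpansion e (fun x ↦ F x * G x) := by
  obtain ⟨a, ha⟩ := hF
  obtain ⟨b, hb⟩ := hG
  let s : ι × ι → ι := fun x ↦ x.1 + x.2
  refine ⟨fun p ↦ ∑' x : {x // s x = p}, a x.1.1 * b x.1.2, fun z ↦ ?_⟩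
  have hsum := summable_mul_of_summable_norm (ha z).summable.norm (hb z).summable.norm
  have hprod := (ha z).mul (hb z) hsum
  have hσ := ((Equiv.sigmaFiberEquiv s).hasSum_iff).mpr hprod
  have hmain := hσ.sigma fun p ↦ (hσ.summable.sigma_factor p).hasSum
  refine (congrArg (fun u ↦ HasSum u (F z * G z)) (funext fun p ↦ ?_)).mpr hmain
  rw [← tsum_mul_right]
  refine tsum_congr fun x ↦ ?_
  have hx : x.1.1 + x.1.2 = p := x.2
  simp only [Function.comp, Equiv.sigmaFiberEquiv, Equiv.coe_fn_mk]
  have he' := he x.1.1 x.1.2 z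
  rw [hx] at he'
  rw [he']
  ring

/-- Transport of an expansion along an injective map of index sets. -/
lemma HasExpansion.reindex {κ Y : Type*} {e : ι → X → ℂ} {F : X → ℂ} (hF : HasExpansion e F)
    {e' : κ → Y → ℂ} (j : ι → κ) (hj : Function.Injective j) (r : Y → X)
    (h : ∀ p y, e' (j p) y = e p (r y)) : HasExpansion e' (fun y ↦ F (r y)) := by
  obtain ⟨a, ha⟩ := hF
  refine ⟨Function.extend j a 0, fun y ↦ (hj.hasSum_iff fun p hp ↦ ?_).mp ?_⟩
  · rw [Function.extend_apply' _ _ _ (by simpa using hp)]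
    simp
  · convert ha (r y) using 2 with p
    simp [hj.extend_apply, h]

end Expansion

/-- The monomial `q ^ n * ζ ^ l`, for `p = (n, l)` and `x = (τ, z)`. -/
def qz (p : ℕ × ℤ) (x : ℍ × ℂ) : ℂ := cexp (2 * π * I * (p.1 * x.1 + p.2 * x.2))

lemma qz_add (p p' : ℕ × ℤ) (x : ℍ × ℂ) : qz (p + p') x = qz p x * qz p' x := by
  simp only [qz, ← Complex.exp_add, Prod.fst_add, Prod.snd_add]
  push_cast
  ring_nf

lemma norm_qz (p : ℕ × ℤ) (x : ℍ × ℂ) :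
    ‖qz p x‖ = Real.exp (-(2 * π) * (p.1 * x.1.im + p.2 * x.2.im)) := by
  rw [qz, Complex.norm_exp]
  congr 1
  simp [mul_assoc]
  ring

/-- The region `Im τ > t`, `|Im z| < R`. -/
def strip (t R : ℝ) : Set (ℂ × ℂ) := {w | t < w.1.im ∧ -R < w.2.im ∧ w.2.im < R}

lemma isOpen_strip (t R : ℝ) : IsOpen (strip t R) := by
  have h1 : Continuous fun w : ℂ × ℂ ↦ w.1.im := by fun_prop
  have h2 : Continuous fun w : ℂ × ℂ ↦ w.2.im := by fun_prop
  exact (isOpen_lt continuous_const h1).inter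
    ((isOpen_lt continuous_const h2).inter (isOpen_lt h2 continuous_const))

lemma convex_strip (t R : ℝ) : Convex ℝ (strip t R) := by
  have h1 : IsLinearMap ℝ fun w : ℂ × ℂ ↦ w.1.im := ⟨by simp, by simp⟩
  have h2 : IsLinearMap ℝ fun w : ℂ × ℂ ↦ w.2.im := ⟨by simp, by simp⟩
  exact (convex_halfSpace_gt h1 t).inter
    ((convex_halfSpace_gt h2 (-R)).inter (convex_halfSpace_lt h2 R))

/-- The terms of an everywhere convergent expansion decay exponentially, which leaves room for the
polynomial factors that come from differentiation. -/
lemma summable_bound {a : ℕ × ℤ → ℂ} (ha : ∀ x, Summable fun p ↦ a p * qz p x) {t : ℝ} (ht : 0 < t)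
    (R : ℝ) : Summable fun p : ℕ × ℤ ↦
      ‖a p‖ * (Real.exp (-(2 * π) * p.1 * t) * Real.exp (2 * π * |(p.2 : ℝ)| * R) *
        (2 * π * (p.1 + |(p.2 : ℝ)|))) := by
  have key (s : ℝ) : Summable fun p : ℕ × ℤ ↦
      ‖a p‖ * Real.exp (-(2 * π) * (p.1 * (t / 2) + p.2 * s)) := by
    have := (ha (⟨⟨0, t / 2⟩, by simpa using ht⟩, ⟨0, s⟩)).norm
    simpa [norm_mul, norm_qz] using this
  refine Summable.of_nonneg_of_le (fun p ↦ by positivity) (fun p ↦ ?_)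
    (((key (R + 1)).add (key (-(R + 1)))).mul_left (2 / t + 1))
  rw [← mul_add, mul_left_comm (2 / t + 1)]
  refine mul_le_mul_of_nonneg_left ?_ (norm_nonneg (a p))
  have e1 : 2 * π * (p.1 : ℝ) ≤ 2 / t * Real.exp (π * p.1 * t) := by
    have := Real.add_one_le_exp (π * p.1 * t)
    rw [div_mul_eq_mul_div, le_div_iff₀ ht]
    nlinarith
  have e2 : 2 * π * |(p.2 : ℝ)| ≤ Real.exp (2 * π * |(p.2 : ℝ)|) := by
    linarith [Real.add_one_le_exp (2 * π * |(p.2 : ℝ)|)]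
  have o1 : 1 ≤ Real.exp (π * p.1 * t) := Real.one_le_exp (by positivity)
  have o2 : 1 ≤ Real.exp (2 * π * |(p.2 : ℝ)|) := Real.one_le_exp (by positivity)
  have e3 : 2 * π * (p.1 + |(p.2 : ℝ)|) ≤
      (2 / t + 1) * (Real.exp (π * p.1 * t) * Real.exp (2 * π * |(p.2 : ℝ)|)) := by
    have h1 : 2 / t * Real.exp (π * p.1 * t) ≤
        2 / t * (Real.exp (π * p.1 * t) * Real.exp (2 * π * |(p.2 : ℝ)|)) := by
      refine mul_le_mul_of_nonneg_left ?_ (by positivity)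
      exact le_mul_of_one_le_right (by positivity) o2
    have h2 : Real.exp (2 * π * |(p.2 : ℝ)|) ≤
        Real.exp (π * p.1 * t) * Real.exp (2 * π * |(p.2 : ℝ)|) :=
      le_mul_of_one_le_left (by positivity) o1
    linarith
  have e4 : Real.exp (-(2 * π) * p.1 * t) * Real.exp (2 * π * |(p.2 : ℝ)| * R) *
      (Real.exp (π * p.1 * t) * Real.exp (2 * π * |(p.2 : ℝ)|)) =
      Real.exp (-(2 * π) * (p.1 * (t / 2)) + 2 * π * |(p.2 : ℝ)| * (R + 1)) := by
    simp only [← Real.exp_add]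
    congr 1
    ring
  have e5 : Real.exp (-(2 * π) * (p.1 * (t / 2)) + 2 * π * |(p.2 : ℝ)| * (R + 1)) ≤
      Real.exp (-(2 * π) * (p.1 * (t / 2) + p.2 * (R + 1))) +
        Real.exp (-(2 * π) * (p.1 * (t / 2) + p.2 * (-(R + 1)))) := by
    rcases abs_cases (p.2 : ℝ) with ⟨h, -⟩ | ⟨h, -⟩ <;> rw [h]
    · refine le_add_of_nonneg_of_le (by positivity) (le_of_eq ?_)
      ring_nf
    · refine le_add_of_le_of_nonneg (le_of_eq ?_) (by positivity)
      ring_nf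
  calc _ ≤ Real.exp (-(2 * π) * p.1 * t) * Real.exp (2 * π * |(p.2 : ℝ)| * R) *
        ((2 / t + 1) * (Real.exp (π * p.1 * t) * Real.exp (2 * π * |(p.2 : ℝ)|))) := by gcongr
    _ = (2 / t + 1) * (Real.exp (-(2 * π) * p.1 * t) * Real.exp (2 * π * |(p.2 : ℝ)| * R) *
      (Real.exp (π * p.1 * t) * Real.exp (2 * π * |(p.2 : ℝ)|))) := by ring
    _ ≤ _ := by rw [e4]; gcongr

/-- The coefficients `2πi (n, l)` of the total derivative of `q ^ n * ζ ^ l`. -/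
def qzDeriv (p : ℕ × ℤ) : ℂ × ℂ →L[ℂ] ℂ :=
  (2 * π * I) • ((p.1 : ℂ) • ContinuousLinearMap.fst ℂ ℂ ℂ + (p.2 : ℂ) • ContinuousLinearMap.snd ℂ ℂ ℂ)

lemma norm_qzDeriv_le (p : ℕ × ℤ) : ‖qzDeriv p‖ ≤ 2 * π * (p.1 + |(p.2 : ℝ)|) := by
  rw [qzDeriv, norm_smul]
  have h0 : ‖(2 * π * I : ℂ)‖ = 2 * π := by simp [abs_of_pos Real.pi_pos]
  rw [h0]
  gcongr
  refine (norm_add_le _ _).trans (add_le_add ?_ ?_) <;> rw [norm_smul]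
  · simp
  · simp

/-- A function with an everywhere convergent expansion can be differentiated term by term. -/
lemma hasFDerivAt_of_hasSum {a : ℕ × ℤ → ℂ} {F : ℍ → ℂ → ℂ}
    (ha : ∀ x : ℍ × ℂ, HasSum (fun p ↦ a p * qz p x) (F x.1 x.2)) (τ : ℍ) (z : ℂ) :
    ∃ f' : ℂ × ℂ →L[ℂ] ℂ, HasSum (fun p ↦ (a p * qz p (τ, z)) • qzDeriv p) f' ∧
      HasFDerivAt (fun w : ℂ × ℂ ↦ F (ofComplex w.1) w.2) f' ((τ : ℂ), z) := by
  set t := τ.im / 2 with ht_def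
  have ht : 0 < t := half_pos τ.im_pos
  set R := |z.im| + 1 with hR_def
  have hmem : ((τ : ℂ), z) ∈ strip t R := by
    refine ⟨by simpa [ht_def] using τ.im_pos, ?_, ?_⟩ <;>
      simp only [hR_def] <;> cases abs_cases z.im <;> linarith
  have hu := summable_bound (fun x ↦ (ha x).summable) ht R
  let f : ℕ × ℤ → ℂ × ℂ → ℂ := fun p w ↦ a p * cexp (2 * π * I * (p.1 * w.1 + p.2 * w.2))
  let f' : ℕ × ℤ → ℂ × ℂ → (ℂ × ℂ →L[ℂ] ℂ) := fun p w ↦ f p w • qzDeriv p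
  have hf : ∀ p w, w ∈ strip t R → HasFDerivAt (f p) (f' p w) w := by
    intro p w _
    have h1 : HasFDerivAt (fun w : ℂ × ℂ ↦ 2 * π * I * (p.1 * w.1 + p.2 * w.2)) (qzDeriv p) w := by
      have := (((hasFDerivAt_fst (𝕜 := ℂ) (p := w)).const_mul (p.1 : ℂ)).add
        ((hasFDerivAt_snd (𝕜 := ℂ) (p := w)).const_mul (p.2 : ℂ))).const_mul (2 * π * I : ℂ)
      exact this
    have h2 := (h1.cexp).const_mul (a p)
    rw [smul_smul] at h2
    exact h2
  have hf' : ∀ p w, w ∈ strip t R → ‖f' p w‖ ≤ ‖a p‖ * (Real.exp (-(2 * π) * p.1 * t) *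
      Real.exp (2 * π * |(p.2 : ℝ)| * R) * (2 * π * (p.1 + |(p.2 : ℝ)|))) := by
    rintro p w ⟨h1, h2, h3⟩
    simp only [f', f]
    rw [norm_smul, norm_mul, mul_assoc]
    refine mul_le_mul_of_nonneg_left (mul_le_mul ?_ (norm_qzDeriv_le p) (norm_nonneg _)
      (by positivity)) (norm_nonneg _)
    rw [Complex.norm_exp, ← Real.exp_add, Real.exp_le_exp]
    have e : (2 * π * I * (p.1 * w.1 + p.2 * w.2) : ℂ).re =
        -(2 * π) * (p.1 * w.1.im + p.2 * w.2.im) := by simp [mul_assoc]; ring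
    rw [e]
    have i1 : (p.1 : ℝ) * t ≤ p.1 * w.1.im := by gcongr
    have i2 : -((p.2 : ℝ) * w.2.im) ≤ |(p.2 : ℝ)| * R := by
      refine (neg_le_abs _).trans ?_
      rw [abs_mul]
      gcongr
      exact abs_le.mpr ⟨h2.le, h3.le⟩
    nlinarith [Real.pi_pos]
  have hs0 : Summable fun p ↦ f p ((τ : ℂ), z) := (ha (τ, z)).summable
  have hsum' : Summable fun p ↦ f' p ((τ : ℂ), z) := .of_norm_bounded hu fun p ↦ hf' p _ hmem
  have hD := hasFDerivAt_tsum_of_isPreconnected hu (isOpen_strip t R)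
    (convex_strip t R).isPreconnected hf hf' hmem hs0 hmem
  refine ⟨_, hsum'.hasSum, hD.congr_of_eventuallyEq ?_⟩
  filter_upwards [(isOpen_strip t R).mem_nhds hmem] with w hw
  have h0 : 0 < w.1.im := ht.trans hw.1
  have := (ha (⟨w.1, h0⟩, w.2)).tsum_eq
  simp only [UpperHalfPlane.ofComplex_apply_of_im_pos h0, f]
  rw [← this]
  rfl

/-- A function on `ℍ × ℂ` with an expansion `∑ a(n, l) q ^ n ζ ^ l` over `n ≥ 0`, `l ∈ ℤ`. -/
def IsWeak (F : ℍ → ℂ → ℂ) : Prop := HasExpansion qz fun x : ℍ × ℂ ↦ F x.1 x.2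

lemma IsWeak.add {F G : ℍ → ℂ → ℂ} (hF : IsWeak F) (hG : IsWeak G) :
    IsWeak fun τ z ↦ F τ z + G τ z := HasExpansion.add hF hG

lemma IsWeak.sub {F G : ℍ → ℂ → ℂ} (hF : IsWeak F) (hG : IsWeak G) :
    IsWeak fun τ z ↦ F τ z - G τ z := HasExpansion.sub hF hG

lemma IsWeak.mul {F G : ℍ → ℂ → ℂ} (hF : IsWeak F) (hG : IsWeak G) :
    IsWeak fun τ z ↦ F τ z * G τ z := HasExpansion.mul qz_add hF hG

lemma IsWeak.const_mul {F : ℍ → ℂ → ℂ} (c : ℂ) (hF : IsWeak F) :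
    IsWeak fun τ z ↦ c * F τ z := HasExpansion.const_mul c hF

lemma isWeak_zeta : IsWeak fun _ z ↦ cexp (2 * π * I * z) := by
  refine ⟨Pi.single (0, 1) 1, fun x ↦ ?_⟩
  convert hasSum_single ((0, 1) : ℕ × ℤ) fun p hp ↦ ?_ using 1
  · simp [qz]
  · simp [hp]

lemma IsWeak.differentiableAt {F : ℍ → ℂ → ℂ} (hF : IsWeak F) (τ : ℍ) (z : ℂ) :
    DifferentiableAt ℂ (fun w : ℂ × ℂ ↦ F (ofComplex w.1) w.2) ((τ : ℂ), z) := by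
  obtain ⟨a, ha⟩ := hF
  obtain ⟨f', -, h⟩ := hasFDerivAt_of_hasSum ha τ z
  exact h.differentiableAt

lemma IsWeak.differentiable {F : ℍ → ℂ → ℂ} (hF : IsWeak F) (τ : ℍ) :
    Differentiable ℂ (F τ) := by
  intro z
  have h : DifferentiableAt ℂ (fun w : ℂ ↦ ((τ : ℂ), w)) z := by fun_prop
  simpa [Function.comp_def] using (hF.differentiableAt τ z).comp z h

lemma IsWeak.differentiableAt_left {F : ℍ → ℂ → ℂ} (hF : IsWeak F) (τ : ℍ) (z : ℂ) :
    DifferentiableAt ℂ (fun w : ℂ ↦ F (ofComplex w) z) τ := by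
  have h : DifferentiableAt ℂ (fun w : ℂ ↦ (w, z)) (τ : ℂ) := by fun_prop
  simpa [Function.comp_def] using (hF.differentiableAt τ z).comp (τ : ℂ) h

/-- The derivative in `z` of a series with coefficients `a(n, l)` is the series with coefficients
`2πi l a(n, l)`. -/
lemma hasSum_deriv {a : ℕ × ℤ → ℂ} {F : ℍ → ℂ → ℂ}
    (ha : ∀ x : ℍ × ℂ, HasSum (fun p ↦ a p * qz p x) (F x.1 x.2)) (x : ℍ × ℂ) :
    HasSum (fun p ↦ 2 * π * I * p.2 * a p * qz p x) (deriv (F x.1) x.2) := by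
  obtain ⟨τ, z⟩ := x
  obtain ⟨f', hs, h⟩ := hasFDerivAt_of_hasSum ha τ z
  have h1 : HasDerivAt (fun w : ℂ ↦ ((τ : ℂ), w)) ((0 : ℂ), (1 : ℂ)) z :=
    (hasDerivAt_const z (τ : ℂ)).prodMk (hasDerivAt_id z)
  have h2 : HasDerivAt (F τ) (f' ((0 : ℂ), (1 : ℂ))) z := by
    simpa [Function.comp_def] using h.comp_hasDerivAt z h1
  rw [h2.deriv]
  have h3 := hs.mapL (ContinuousLinearMap.apply ℂ ℂ ((0 : ℂ), (1 : ℂ)))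
  have e (p : ℕ × ℤ) : 2 * π * I * p.2 * a p * qz p (τ, z) =
      ContinuousLinearMap.apply ℂ ℂ ((0 : ℂ), (1 : ℂ)) ((a p * qz p (τ, z)) • qzDeriv p) := by
    have e' : ContinuousLinearMap.apply ℂ ℂ ((0 : ℂ), (1 : ℂ))
        ((a p * qz p (τ, z)) • qzDeriv p) =
        (a p * qz p (τ, z)) * ((2 * π * I) * ((p.1 : ℂ) * 0 + (p.2 : ℂ) * 1)) := rfl
    rw [e']
    ring
  simp only [e]
  exact h3

lemma IsWeak.deriv {F : ℍ → ℂ → ℂ} (hF : IsWeak F) : IsWeak fun τ ↦ deriv (F τ) := by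
  obtain ⟨a, ha⟩ := hF
  exact ⟨_, hasSum_deriv ha⟩

/-- The restriction of an expansion to a fixed value of `z`, as a function constant in `z`. -/
lemma IsWeak.eval {F : ℍ → ℂ → ℂ} (hF : IsWeak F) (z₀ : ℂ) : IsWeak fun τ _ ↦ F τ z₀ := by
  obtain ⟨a, ha⟩ := hF
  let b : ℕ → ℂ := fun n ↦ ∑' l : ℤ, a (n, l) * cexp (2 * π * I * (l * z₀))
  have hb (τ : ℍ) : HasSum (fun n ↦ b n * cexp (2 * π * I * (n * τ))) (F τ z₀) := by
    have h := ha (τ, z₀)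
    have := h.prod_fiberwise fun n ↦ (h.summable.prod_factor n).hasSum
    convert this using 2 with n
    simp only [b]
    rw [← tsum_mul_right]
    refine tsum_congr fun l ↦ ?_
    simp only [qz]
    rw [mul_assoc, ← Complex.exp_add]
    ring_nf
  have hinj : Function.Injective fun n : ℕ ↦ ((n, 0) : ℕ × ℤ) := fun _ _ h ↦ (Prod.mk.inj h).1
  refine ⟨fun p ↦ if p.2 = 0 then b p.1 else 0, fun x ↦ (hinj.hasSum_iff ?_).mp ?_⟩
  · rintro ⟨n, l⟩ hl
    have : l ≠ 0 := by rintro rfl; exact hl ⟨n, rfl⟩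
    simp [this]
  · simpa [Function.comp_def, qz] using hb x.1

/-- As `Im τ → ∞` only the `q ^ 0`-term of an expansion survives. -/
lemma tendsto_of_hasSum {a : ℕ × ℤ → ℂ} {F : ℍ → ℂ → ℂ}
    (ha : ∀ x : ℍ × ℂ, HasSum (fun p ↦ a p * qz p x) (F x.1 x.2)) (z : ℂ) :
    Tendsto (F · z) UpperHalfPlane.atImInfty
      (𝓝 (∑' l : ℤ, a (0, l) * cexp (2 * π * I * (l * z)))) := by
  have hinj : Function.Injective fun l : ℤ ↦ ((0, l) : ℕ × ℤ) := fun _ _ h ↦ (Prod.mk.inj h).2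
  let g : ℕ × ℤ → ℂ := fun p ↦ if p.1 = 0 then a p * cexp (2 * π * I * (p.2 * z)) else 0
  have hg : ∑' l : ℤ, a (0, l) * cexp (2 * π * I * (l * z)) = ∑' p, g p := by
    have : Function.support g ⊆ Set.range fun l : ℤ ↦ ((0, l) : ℕ × ℤ) := by
      rintro ⟨n, l⟩ h
      have : n = 0 := by by_contra hn; simp [g, hn] at h
      exact ⟨l, by simp [this]⟩
    rw [← hinj.tsum_eq this]
    simp [g]
  have hF : (F · z) = fun τ ↦ ∑' p, a p * qz p (τ, z) := funext fun τ ↦ (ha (τ, z)).tsum_eq.symm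
  rw [hg, hF]
  refine tendsto_tsum_of_dominated_convergence (bound := fun p ↦ ‖a p * qz p (UpperHalfPlane.I, z)‖)
    (ha (UpperHalfPlane.I, z)).summable.norm ?_ ?_
  · rintro ⟨n, l⟩
    by_cases hn : n = 0
    · subst hn
      simp [g, qz]
    · simp only [g, hn, if_false]
      rw [tendsto_zero_iff_norm_tendsto_zero]
      have h1 : Tendsto (fun τ : ℍ ↦ Real.exp (-(2 * π) * (n * τ.im + l * z.im)))
          UpperHalfPlane.atImInfty (𝓝 0) := by
        refine Real.tendsto_exp_atBot.comp ?_
        have hn' : (0 : ℝ) < n := by exact_mod_cast Nat.pos_of_ne_zero hn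
        have him : Tendsto UpperHalfPlane.im UpperHalfPlane.atImInfty atTop := tendsto_comap
        exact (tendsto_atTop_add_const_right _ (l * z.im : ℝ)
          (him.const_mul_atTop hn')).const_mul_atTop_of_neg
            (show -(2 * π) < 0 by linarith [Real.pi_pos])
      simpa [norm_qz] using h1.const_mul ‖a (n, l)‖
  · have : ∀ᶠ τ : ℍ in UpperHalfPlane.atImInfty, 1 ≤ τ.im :=
      tendsto_comap.eventually (eventually_ge_atTop 1)
    filter_upwards [this] with τ hτ p
    rw [norm_mul, norm_mul, norm_qz, norm_qz]
    refine mul_le_mul_of_nonneg_left (Real.exp_le_exp.mpr ?_) (norm_nonneg _)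
    have : (p.1 : ℝ) * 1 ≤ p.1 * τ.im := by gcongr
    simp only [UpperHalfPlane.I_im]
    nlinarith [Real.pi_pos]

/-! ### The odd Jacobi theta function -/

/-- The theta series without its fractional powers:
`ϑ(τ, z) = q ^ (1/8) ζ ^ (1/2) ∑ (-1) ^ n q ^ (n(n+1)/2) ζ ^ n`. -/
def thetaSeries (τ : ℍ) (z : ℂ) : ℂ := jacobiTheta₂ (z + 1 / 2 + τ / 2) τ

lemma neg_one_zpow_eq_cexp (n : ℤ) : (-1 : ℂ) ^ n = cexp (π * I * n) := by
  rw [mul_comm, Complex.exp_int_mul, Complex.exp_pi_mul_I]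

lemma jacobiTheta₂_term_shift (n : ℤ) (τ : ℍ) (z : ℂ) :
    jacobiTheta₂_term n (z + 1 / 2 + τ / 2) τ =
      (-1 : ℂ) ^ n * cexp (2 * π * I * (n * (n + 1) / 2 * τ + n * z)) := by
  rw [neg_one_zpow_eq_cexp, jacobiTheta₂_term, ← Complex.exp_add]
  ring_nf

lemma theta_eq (τ : ℍ) (z : ℂ) :
    theta τ z = cexp (2 * π * I * τ / 8) * (cexp (π * I * z) * thetaSeries τ z) := by
  rw [theta, thetaSeries, jacobiTheta₂]
  refine congrArg _ ?_
  rw [← tsum_mul_left]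
  refine tsum_congr fun n ↦ ?_
  rw [jacobiTheta₂_term_shift, mul_left_comm, ← Complex.exp_add, mul_assoc, ← Complex.exp_add]
  ring_nf

/-- The coefficients of `thetaSeries`. -/
def thetaCoeff (p : ℕ × ℤ) : ℂ := if 2 * (p.1 : ℤ) = p.2 * (p.2 + 1) then (-1) ^ p.2 else 0

lemma hasSum_thetaSeries (x : ℍ × ℂ) :
    HasSum (fun p ↦ thetaCoeff p * qz p x) (thetaSeries x.1 x.2) := by
  obtain ⟨τ, z⟩ := x
  have hs := hasSum_jacobiTheta₂_term (z + 1 / 2 + τ / 2) τ.im_pos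
  have hn (n : ℤ) : ∃ N : ℕ, 2 * (N : ℤ) = n * (n + 1) := by
    obtain ⟨k, hk⟩ := Int.even_mul_succ_self n
    have h0 : 0 ≤ n * (n + 1) := by
      rcases le_or_gt 0 n with h | h
      · positivity
      · exact mul_nonneg_of_nonpos_of_nonpos h.le (by omega)
    exact ⟨k.toNat, by omega⟩
  choose N hN using hn
  have hinj : Function.Injective fun n : ℤ ↦ (N n, n) := fun _ _ h ↦ (Prod.mk.inj h).2
  refine (hinj.hasSum_iff ?_).mp ?_
  · rintro ⟨m, l⟩ h
    have : 2 * (m : ℤ) ≠ l * (l + 1) := by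
      intro h'
      refine h ⟨l, ?_⟩
      have := hN l
      simp only [Prod.mk.injEq, and_true]
      omega
    simp [thetaCoeff, this]
  · refine (congrArg (HasSum · _) (funext fun n ↦ ?_)).mpr hs
    simp only [Function.comp_apply, thetaCoeff, hN, if_true, qz]
    rw [jacobiTheta₂_term_shift]
    have : (N n : ℂ) = n * (n + 1) / 2 := by
      rw [eq_div_iff two_ne_zero, mul_comm]
      exact_mod_cast hN n
    rw [this]

lemma isWeak_thetaSeries : IsWeak thetaSeries := ⟨_, hasSum_thetaSeries⟩

lemma differentiable_theta (τ : ℍ) : Differentiable ℂ (theta τ) := by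
  have h := isWeak_thetaSeries.differentiable τ
  simp only [funext (theta_eq τ)]
  fun_prop

lemma theta_add_one (τ : ℍ) (z : ℂ) : theta τ (z + 1) = -theta τ z := by
  have h : thetaSeries τ (z + 1) = thetaSeries τ z := by
    rw [thetaSeries, thetaSeries, ← jacobiTheta₂_add_left (z + 1 / 2 + τ / 2)]
    ring_nf
  rw [theta_eq, theta_eq, h, mul_add, mul_one, Complex.exp_add, Complex.exp_pi_mul_I]
  ring

lemma theta_add_tau (τ : ℍ) (z : ℂ) :
    theta τ (z + τ) = -(cexp (-(π * I * τ) - 2 * π * I * z) * theta τ z) := by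
  have h : thetaSeries τ (z + τ) =
      cexp (-π * I * (τ + 2 * (z + 1 / 2 + τ / 2))) * thetaSeries τ z := by
    rw [thetaSeries, thetaSeries, ← jacobiTheta₂_add_left']
    ring_nf
  have e : cexp (-(π * I)) = -1 := by rw [Complex.exp_neg, Complex.exp_pi_mul_I]; norm_num
  rw [theta_eq, theta_eq, h, neg_eq_neg_one_mul (_ * _)]
  conv_rhs => rw [← e]
  simp only [← mul_assoc, ← Complex.exp_add]
  congr 2
  ring

lemma theta_neg (τ : ℍ) (z : ℂ) : theta τ (-z) = -theta τ z := by
  have h : thetaSeries τ z = cexp (-π * I * (2 * z + 1)) * thetaSeries τ (-z) := by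
    have h1 : thetaSeries τ (-z) = jacobiTheta₂ (z - 1 / 2 - τ / 2) τ := by
      rw [thetaSeries, ← jacobiTheta₂_neg_left]
      ring_nf
    have h2 : z + 1 / 2 + (τ : ℂ) / 2 = z - 1 / 2 - τ / 2 + 1 + τ := by ring
    rw [h1, thetaSeries, h2, jacobiTheta₂_add_left', jacobiTheta₂_add_left]
    ring_nf
  rw [theta_eq, theta_eq, h]
  have e2 : cexp (π * I * -z) = - (cexp (π * I * z) * cexp (-π * I * (2 * z + 1))) := by
    rw [neg_eq_neg_one_mul (_ * _), ← Complex.exp_add]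
    conv_rhs => rw [← Complex.exp_pi_mul_I, ← Complex.exp_add]
    ring_nf
  rw [e2]
  ring

@[simp] lemma theta_zero (τ : ℍ) : theta τ 0 = 0 := by
  have := theta_neg τ 0
  rw [neg_zero] at this
  linear_combination this / 2

lemma theta_vadd_one (τ : ℍ) (z : ℂ) :
    theta ((1 : ℝ) +ᵥ τ) z = cexp (π * I / 4) * theta τ z := by
  simp only [theta, UpperHalfPlane.coe_vadd, ofReal_one]
  rw [← mul_assoc]
  congr 1
  · rw [← Complex.exp_add]
    ring_nf
  · refine tsum_congr fun n ↦ ?_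
    congr 2
    obtain ⟨k, hk⟩ := Int.even_mul_succ_self n
    have hk' : (n : ℂ) * (n + 1) / 2 = k := by
      rw [div_eq_iff two_ne_zero, mul_two]
      exact_mod_cast hk
    rw [hk', mul_add, Complex.exp_add, mul_one]
    rw [show (2 * π * I * k : ℂ) = k * (2 * π * I) by ring, Complex.exp_int_mul_two_pi_mul_I,
      one_mul]

lemma coe_S_smul (τ : ℍ) : ((ModularGroup.S • τ : ℍ) : ℂ) = -1 / τ := by
  rw [UpperHalfPlane.modular_S_smul]
  change (-(τ : ℂ))⁻¹ = -1 / τ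
  rw [inv_neg, neg_div, one_div]

lemma theta_S_smul_sq (τ : ℍ) (z : ℂ) :
    theta (ModularGroup.S • τ) (z / τ) ^ 2 =
      I * τ * cexp (2 * π * I * (z ^ 2 / τ)) * theta τ z ^ 2 := by
  have hτ : (τ : ℂ) ≠ 0 := τ.ne_zero
  have hc := coe_S_smul τ
  have h1 : thetaSeries τ z = jacobiTheta₂ (z - 1 / 2 + τ / 2) τ := by
    rw [thetaSeries, ← jacobiTheta₂_add_left (z - 1 / 2 + τ / 2)]
    ring_nf
  have h2 : thetaSeries (ModularGroup.S • τ) (z / τ) =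
      jacobiTheta₂ ((z - 1 / 2 + τ / 2) / τ) (-1 / τ) := by
    rw [thetaSeries, hc]
    congr 1
    field_simp
    ring
  have hsq : ((-I * τ) ^ (1 / 2 : ℂ)) ^ 2 = -I * τ := by
    rw [← Complex.cpow_nat_mul]
    norm_num
  have hne : -I * (τ : ℂ) ≠ 0 := by simp [hτ]
  have h3 := congrArg (· ^ 2) (jacobiTheta₂_functional_equation (z - 1 / 2 + τ / 2) τ)
  simp only [mul_pow, div_pow, one_pow, hsq, ← h1, ← h2] at h3
  rw [div_mul_eq_mul_div, one_mul, div_mul_eq_mul_div, eq_div_iff hne] at h3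
  rw [theta_eq, theta_eq, hc]
  simp only [mul_pow, ← Complex.exp_nat_mul] at h3 ⊢
  have h4 : thetaSeries (ModularGroup.S • τ) (z / τ) ^ 2 =
      cexp (2 * (π * I * (z - 1 / 2 + τ / 2) ^ 2 / τ)) * (-I * τ) * thetaSeries τ z ^ 2 := by
    rw [mul_assoc, mul_comm (-I * (τ : ℂ)), h3, ← mul_assoc, ← Complex.exp_add]
    rw [show (2 * (π * I * (z - 1 / 2 + τ / 2) ^ 2 / τ) +
      (2 : ℕ) * (-π * I * (z - 1 / 2 + τ / 2) ^ 2 / τ) : ℂ) = 0 by push_cast; ring]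
    simp
  rw [h4]
  have e : I = -I * cexp (-(π * I)) := by
    rw [Complex.exp_neg, Complex.exp_pi_mul_I]; norm_num
  have e5 : cexp ((2 : ℕ) * (2 * π * I * (-1 / τ) / 8)) * (cexp ((2 : ℕ) * (π * I * (z / τ))) *
      cexp (2 * (π * I * (z - 1 / 2 + τ / 2) ^ 2 / τ))) =
      cexp (-(π * I)) * cexp (2 * π * I * (z ^ 2 / τ)) *
        (cexp ((2 : ℕ) * (2 * π * I * τ / 8)) * cexp ((2 : ℕ) * (π * I * z))) := by
    simp only [← Complex.exp_add]
    congr 1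
    field_simp
    push_cast
    ring
  have e6 : cexp (-(π * I)) = -1 := by rw [Complex.exp_neg, Complex.exp_pi_mul_I]; norm_num
  rw [e6] at e5
  linear_combination (-I * τ * thetaSeries τ z ^ 2) * e5

lemma eta_vadd_one_pow (τ : ℍ) : ModularForm.eta ((1 : ℝ) +ᵥ τ : ℍ) ^ 6 =
    cexp (π * I / 2) * ModularForm.eta τ ^ 6 := by
  have h1 : ModularForm.eta ((1 : ℝ) +ᵥ τ : ℍ) = cexp (π * I / 12) * ModularForm.eta τ := by
    simp only [ModularForm.eta, UpperHalfPlane.coe_vadd, ofReal_one]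
    rw [← mul_assoc]
    congr 1
    · simp only [Function.Periodic.qParam, ← Complex.exp_add]
      push_cast
      ring_nf
    · refine tprod_congr fun n ↦ ?_
      simp only [ModularForm.eta_q, add_comm (1 : ℂ)]
      rw [show Function.Periodic.qParam 1 ((τ : ℂ) + 1) = Function.Periodic.qParam 1 τ from ?_]
      simp only [Function.Periodic.qParam, mul_add, add_div, Complex.exp_add]
      simp
  rw [h1, mul_pow, ← Complex.exp_nat_mul]
  push_cast
  ring_nf

lemma eta_S_smul_pow (τ : ℍ) : ModularForm.eta (ModularGroup.S • τ : ℍ) ^ 6 =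
    I * τ ^ 3 * ModularForm.eta τ ^ 6 := by
  have hc := coe_S_smul τ
  have h := ModularForm.eta_comp_eq_csqrt_I_inv τ.2
  simp only [Function.comp_apply, Pi.smul_apply, Pi.mul_apply, smul_eq_mul] at h
  have hs (w : ℂ) : sqrt w ^ 6 = w ^ 3 := by
    have : sqrt w ^ 2 = w := by
      rw [sqrt, ← Complex.cpow_nat_mul]; norm_num
    rw [show 6 = 2 * 3 from rfl, pow_mul, this]
  rw [hc, h, mul_pow, mul_pow, inv_pow, hs, hs]
  have : (I ^ 3)⁻¹ = I := by rw [Complex.I_pow_three, inv_neg, Complex.inv_I, neg_neg]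
  rw [this]
  ring

lemma eta_ne_zero (τ : ℍ) : ModularForm.eta τ ≠ 0 := ModularForm.eta_ne_zero τ.2

/-! ### Modular transformations -/

/-- The factor of automorphy `cτ + d`. -/
def autJ (γ : SL(2, ℤ)) (τ : ℍ) : ℂ := (γ 1 0 : ℂ) * τ + (γ 1 1 : ℂ)

lemma autJ_ne_zero (γ : SL(2, ℤ)) (τ : ℍ) : autJ γ τ ≠ 0 := denom_cast_ne_zero γ τ

lemma coe_smul_mul_autJ (γ : SL(2, ℤ)) (τ : ℍ) :
    ((γ • τ : ℍ) : ℂ) * autJ γ τ = (γ 0 0 : ℂ) * τ + (γ 0 1 : ℂ) := by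
  rw [UpperHalfPlane.coe_specialLinearGroup_apply]
  have := autJ_ne_zero γ τ
  simp only [autJ] at this ⊢
  simp [div_mul_cancel₀ _ this]

lemma autJ_mul (γ γ' : SL(2, ℤ)) (τ : ℍ) :
    autJ (γ * γ') τ = autJ γ (γ' • τ) * autJ γ' τ := by
  have h := coe_smul_mul_autJ γ' τ
  rw [show autJ γ (γ' • τ) = (γ 1 0 : ℂ) * (γ' • τ : ℍ) + (γ 1 1 : ℂ) from rfl, add_mul, mul_assoc, h]
  simp only [autJ, Matrix.SpecialLinearGroup.coe_mul, Matrix.mul_apply, Fin.sum_univ_two]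
  push_cast
  ring

/-- The modular transformation law of a Jacobi form of weight `k` and index `1` for the lattice
`A₁`. -/
def IsModular (k : ℤ) (F : ℍ → ℂ → ℂ) : Prop :=
  ∀ (γ : SL(2, ℤ)) (τ : ℍ) (z : ℂ), F (γ • τ) (z / autJ γ τ) =
    autJ γ τ ^ k * cexp (2 * π * I * ((γ 1 0 : ℂ) * z ^ 2 / autJ γ τ)) * F τ z

/-- The cocycle relation of the exponents `c z² / (cτ + d)`. -/
lemma exponent_mul (γ γ' : SL(2, ℤ)) (τ : ℍ) (z : ℂ) :
    ((γ * γ') 1 0 : ℂ) * z ^ 2 / autJ (γ * γ') τ =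
      (γ 1 0 : ℂ) * (z / autJ γ' τ) ^ 2 / autJ γ (γ' • τ) + (γ' 1 0 : ℂ) * z ^ 2 / autJ γ' τ := by
  have h1 := autJ_ne_zero γ' τ
  have h2 := autJ_ne_zero γ (γ' • τ)
  have hm := autJ_mul γ γ' τ
  have hdet : (γ' 0 0 : ℂ) * γ' 1 1 - γ' 0 1 * γ' 1 0 = 1 := by
    have := γ'.det_coe
    rw [Matrix.det_fin_two] at this
    exact_mod_cast this
  have key : (γ 1 0 : ℂ) + γ' 1 0 * autJ (γ * γ') τ = ((γ * γ') 1 0 : ℂ) * autJ γ' τ := by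
    simp only [autJ, Matrix.SpecialLinearGroup.coe_mul, Matrix.mul_apply, Fin.sum_univ_two]
    push_cast
    linear_combination (-(γ 1 0 : ℂ)) * hdet
  rw [hm] at key ⊢
  field_simp
  linear_combination (-z ^ 2) * key

/-- The transformation law holds for all of `SL₂(ℤ)` as soon as it holds for the generators. -/
lemma isModular_of_generators {k : ℤ} {F : ℍ → ℂ → ℂ}
    (hT : ∀ τ z, F ((1 : ℝ) +ᵥ τ) z = F τ z)
    (hS : ∀ τ z, F (ModularGroup.S • τ) (z / τ) =
      (τ : ℂ) ^ k * cexp (2 * π * I * (z ^ 2 / τ)) * F τ z) : IsModular k F := by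
  intro γ
  have hγ : γ ∈ Subgroup.closure {ModularGroup.S, ModularGroup.T} := by
    simp [SpecialLinearGroup.SL2Z_generators]
  induction hγ using Subgroup.closure_induction with
  | one => simp [autJ]
  | mem g hg =>
    rcases hg with rfl | rfl
    · simpa [autJ, ModularGroup.S] using hS
    · intro τ z
      rw [UpperHalfPlane.modular_T_smul, ← hT τ z]
      simp [autJ, ModularGroup.T, hT]
  | mul g h _ _ ig ih =>
    intro τ z
    have h1 := ih τ z
    have h2 := ig (h • τ) (z / autJ h τ)
    rw [h1] at h2
    rw [exponent_mul, autJ_mul, mul_smul, mul_zpow, mul_add, Complex.exp_add, ← div_div,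
      div_right_comm, h2]
    ring
  | inv g _ ig =>
    intro τ z
    have h1 := ig (g⁻¹ • τ) (z / autJ g⁻¹ τ)
    have h2 := exponent_mul g g⁻¹ τ z
    have h3 := autJ_mul g g⁻¹ τ
    have h4 : autJ (1 : SL(2, ℤ)) τ = 1 := by simp [autJ]
    rw [mul_inv_cancel] at h2 h3
    rw [h4] at h3
    simp only [Matrix.SpecialLinearGroup.coe_one, Matrix.one_apply_ne (one_ne_zero : (1 : Fin 2) ≠ 0),
      Int.cast_zero, zero_mul, zero_div] at h2
    rw [smul_inv_smul, div_div, mul_comm (autJ g⁻¹ τ), ← h3, div_one] at h1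
    rw [h1]
    have h5 : autJ g⁻¹ τ ^ k * autJ g (g⁻¹ • τ) ^ k = 1 := by
      rw [← mul_zpow, mul_comm, ← h3, one_zpow]
    have h6 : cexp (2 * π * I * ((g⁻¹ 1 0 : ℤ) * z ^ 2 / autJ g⁻¹ τ)) *
        cexp (2 * π * I * ((g 1 0 : ℂ) * (z / autJ g⁻¹ τ) ^ 2 / autJ g (g⁻¹ • τ))) = 1 := by
      rw [← Complex.exp_add, ← mul_add, add_comm, ← h2, mul_zero, Complex.exp_zero]
    linear_combination (-(F (g⁻¹ • τ) (z / autJ g⁻¹ τ))) * h5 -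
      (autJ g⁻¹ τ ^ k * autJ g (g⁻¹ • τ) ^ k * F (g⁻¹ • τ) (z / autJ g⁻¹ τ)) * h6

lemma isModular_phiNeg2 : IsModular (-2) phiNeg2 := by
  refine isModular_of_generators (fun τ z ↦ ?_) fun τ z ↦ ?_
  · rw [phiNeg2, phiNeg2, theta_vadd_one, eta_vadd_one_pow, mul_pow, ← Complex.exp_nat_mul]
    rw [show ((2 : ℕ) * (π * I / 4) : ℂ) = π * I / 2 by push_cast; ring]
    exact mul_div_mul_left _ _ (Complex.exp_ne_zero _)
  · have h1 := τ.ne_zero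
    have h2 := eta_ne_zero τ
    rw [phiNeg2, phiNeg2, theta_S_smul_sq, eta_S_smul_pow]
    rw [zpow_neg]
    field_simp

/-! ### Even theta functions in one variable -/

/-- The even entire functions with the periodicity in `z` of a Jacobi form of index `m` for `A₁`,
at a fixed `τ`. -/
def evenTheta (τ : ℍ) (m : ℕ) : Submodule ℂ (ℂ → ℂ) where
  carrier := {g | Differentiable ℂ g ∧ (∀ z, g (-z) = g z) ∧ (∀ z, g (z + 1) = g z) ∧
    ∀ z, g (z + τ) = cexp (-(4 * π * I * m * z) - 2 * π * I * m * τ) * g z}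
  zero_mem' := ⟨differentiable_const 0, by simp, by simp, by simp⟩
  add_mem' := by
    rintro f g ⟨h1, h2, h3, h4⟩ ⟨k1, k2, k3, k4⟩
    exact ⟨h1.add k1, fun z ↦ by simp [h2, k2], fun z ↦ by simp [h3, k3],
      fun z ↦ by simp [h4, k4, mul_add]⟩
  smul_mem' := by
    rintro c f ⟨h1, h2, h3, h4⟩
    exact ⟨h1.const_smul c, fun z ↦ by simp [h2], fun z ↦ by simp [h3],
      fun z ↦ by simp [h4, mul_left_comm]⟩

lemma mul_mem_evenTheta {τ : ℍ} {m n : ℕ} {f g : ℂ → ℂ} (hf : f ∈ evenTheta τ m)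
    (hg : g ∈ evenTheta τ n) : f * g ∈ evenTheta τ (m + n) := by
  obtain ⟨h1, h2, h3, h4⟩ := hf
  obtain ⟨k1, k2, k3, k4⟩ := hg
  refine ⟨h1.mul k1, fun z ↦ by simp [h2, k2], fun z ↦ by simp [h3, k3], fun z ↦ ?_⟩
  rw [Pi.mul_apply, h4, k4, mul_mul_mul_comm, ← Complex.exp_add]
  congr 2
  push_cast
  ring

lemma pow_mem_evenTheta {τ : ℍ} {f : ℂ → ℂ} (hf : f ∈ evenTheta τ 1) (n : ℕ) :
    f ^ n ∈ evenTheta τ n := by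
  induction n with
  | zero => exact ⟨differentiable_const 1, by simp, by simp, by simp⟩
  | succ n ih => rw [pow_succ]; exact mul_mem_evenTheta ih hf

/-- The integral of an entire `1`-periodic function over a horizontal period does not depend on
the period: the vertical sides of the rectangle in Cauchy's theorem cancel. -/
lemma integral_add_of_periodic {h : ℂ → ℂ} (hd : Differentiable ℂ h) (hp : ∀ z, h (z + 1) = h z)
    (w : ℂ) : ∫ x in (0 : ℝ)..1, h (x + w) = ∫ x in (0 : ℝ)..1, h x := by
  have hper : Function.Periodic (fun x : ℝ ↦ h (x + w.im * I)) 1 := fun x ↦ by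
    change h (((x + 1 : ℝ) : ℂ) + w.im * I) = _
    beta_reduce
    rw [← hp (x + w.im * I)]
    push_cast
    ring_nf
  have h1 : ∫ x in (0 : ℝ)..1, h (x + w) = ∫ x in (0 : ℝ)..1, h (x + w.im * I) := by
    have e1 (x : ℝ) : h (x + w) = (fun x : ℝ ↦ h (x + w.im * I)) (x + w.re) := by
      have : (w : ℂ) = w.re + w.im * I := (Complex.re_add_im w).symm
      conv_lhs => rw [this]
      push_cast
      ring_nf
    simp only [e1]
    rw [intervalIntegral.integral_comp_add_right (fun x : ℝ ↦ h (x + w.im * I))]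
    have := hper.intervalIntegral_add_eq w.re 0
    simpa [add_comm] using this
  have h2 := Complex.integral_boundary_rect_eq_zero_of_differentiableOn h 0 (1 + w.im * I)
    hd.differentiableOn
  have e2 (y : ℝ) : h (1 + y * I) = h (y * I) := by rw [add_comm, hp]
  simp [e2] at h2
  rw [h1]
  linear_combination -h2

/-- The `n`-th Fourier coefficient of a `1`-periodic function. -/
def fcoeff (g : ℂ → ℂ) (n : ℤ) : ℂ := ∫ x in (0 : ℝ)..1, g x * cexp (-(2 * π * I * n * x))

lemma exp_period (n : ℤ) (z : ℂ) :
    cexp (-(2 * π * I * n * (z + 1))) = cexp (-(2 * π * I * n * z)) := by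
  rw [mul_add, mul_one, neg_add, Complex.exp_add, show -(2 * π * I * n : ℂ) =
    ((-n : ℤ) : ℂ) * (2 * π * I) by push_cast; ring, Complex.exp_int_mul_two_pi_mul_I, mul_one]

lemma eq_zero_of_fcoeff_eq_zero {g : ℂ → ℂ} (hd : Differentiable ℂ g) (hp : ∀ z, g (z + 1) = g z)
    (h0 : ∀ n, fcoeff g n = 0) : g = 0 := by
  funext w
  have hc := hd.continuous
  let f₀ : ℝ → ℂ := fun x ↦ g (x + w)
  have hper : Function.Periodic f₀ 1 := fun x ↦ by
    change g (((x + 1 : ℝ) : ℂ) + w) = g (x + w)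
    rw [← hp (x + w)]
    push_cast
    ring_nf
  have hcont : Continuous f₀ := by fun_prop
  let f : C(AddCircle (1 : ℝ), ℂ) := ⟨hper.lift, continuous_coinduced_dom.mpr hcont⟩
  have hf (x : ℝ) : f (x : AddCircle (1 : ℝ)) = g (x + w) := hper.lift_coe x
  have hcoeff : fourierCoeff f = 0 := by
    funext n
    rw [fourierCoeff_eq_intervalIntegral f n 0]
    simp only [zero_add, div_one, one_smul, hf, Pi.zero_apply, smul_eq_mul]
    have e (x : ℝ) : (fourier (-n) (x : AddCircle (1 : ℝ)) : ℂ) * g (x + w) =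
        cexp (2 * π * I * n * w) * (g (x + w) * cexp (-(2 * π * I * n * (x + w)))) := by
      rw [fourier_coe_apply, mul_left_comm, ← Complex.exp_add, mul_comm]
      push_cast
      ring_nf
    simp only [e]
    rw [intervalIntegral.integral_const_mul]
    have := integral_add_of_periodic (h := fun z ↦ g z * cexp (-(2 * π * I * n * z)))
      (by fun_prop) (fun z ↦ by simp only [hp, exp_period]) w
    rw [this]
    simpa [fcoeff] using h0 n
  have hsum := has_pointwise_sum_fourier_series_of_summable
    (f := f) (by rw [hcoeff]; exact summable_zero) ((0 : ℝ) : AddCircle (1 : ℝ))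
  rw [hcoeff, hf] at hsum
  simpa using hsum.unique (by simp [hasSum_zero])

section

variable {τ : ℍ} {m : ℕ} {g : ℂ → ℂ}

lemma fcoeff_neg (hg : g ∈ evenTheta τ m) (n : ℤ) : fcoeff g (-n) = fcoeff g n := by
  obtain ⟨h1, h2, h3, -⟩ := hg
  let u : ℝ → ℂ := fun x ↦ g x * cexp (-(2 * π * I * n * x))
  have hper : Function.Periodic u 1 := fun x ↦ by
    simp only [u]
    push_cast
    rw [h3, exp_period]
  have e (x : ℝ) : g x * cexp (-(2 * π * I * (-n : ℤ) * x)) = u (-x) := by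
    simp only [u]
    push_cast
    rw [h2]
    ring_nf
  simp only [fcoeff, e]
  rw [intervalIntegral.integral_comp_neg]
  have := hper.intervalIntegral_add_eq (-1) 0
  simpa using this

lemma fcoeff_shift (hg : g ∈ evenTheta τ m) (n : ℤ) :
    fcoeff g n = cexp (-(2 * π * I * (m + n) * τ)) * fcoeff g (n + 2 * m) := by
  obtain ⟨h1, -, h3, h4⟩ := hg
  have := integral_add_of_periodic (h := fun z ↦ g z * cexp (-(2 * π * I * n * z)))
    (by fun_prop) (fun z ↦ by simp only [h3, exp_period]) τ
  rw [fcoeff, ← this, fcoeff, ← intervalIntegral.integral_const_mul]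
  refine intervalIntegral.integral_congr fun x _ ↦ ?_
  rw [h4, mul_right_comm, ← Complex.exp_add, mul_left_comm, ← Complex.exp_add, mul_comm]
  push_cast
  ring_nf

lemma fcoeff_shift_iff (hg : g ∈ evenTheta τ m) (n : ℤ) :
    fcoeff g n = 0 ↔ fcoeff g (n + 2 * m) = 0 := by
  rw [fcoeff_shift hg n]
  simp [Complex.exp_ne_zero]

/-- An even theta function of index `m` is determined by `m + 1` of its Fourier coefficients, by
the recursion between the coefficients `n` and `n + 2m` and the symmetry `n ↔ -n`. -/
lemma eq_zero_of_fcoeff (hg : g ∈ evenTheta τ m) (h0 : ∀ n : ℕ, n ≤ m → fcoeff g n = 0) :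
    g = 0 := by
  refine eq_zero_of_fcoeff_eq_zero hg.1 hg.2.2.1 fun n ↦ ?_
  rcases Nat.eq_zero_or_pos m with rfl | hm
  · rcases eq_or_ne n 0 with rfl | hn
    · simpa using h0 0 le_rfl
    · have h := fcoeff_shift hg n
      simp only [Nat.cast_zero, mul_zero, add_zero, zero_add] at h
      by_contra hne
      have h1 : cexp (-(2 * π * I * n * τ)) = 1 := by
        have := mul_right_cancel₀ hne (h.symm.trans (one_mul _).symm)
        exact this
      have h2 := congrArg norm h1
      rw [Complex.norm_exp, norm_one, Real.exp_eq_one_iff] at h2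
      simp [Real.pi_ne_zero, hn, τ.im_ne_zero] at h2
  · have hk (r : ℤ) (k : ℤ) : fcoeff g r = 0 ↔ fcoeff g (r + 2 * m * k) = 0 := by
      induction k using Int.induction_on with
      | zero => simp
      | succ k ih =>
        rw [ih, fcoeff_shift_iff hg]
        ring_nf
      | pred k ih =>
        rw [ih, fcoeff_shift_iff hg (r + 2 * m * (-k - 1))]
        ring_nf
    have hm' : (0 : ℤ) < 2 * m := by positivity
    have hr0 := Int.emod_nonneg n hm'.ne'
    have hr1 := Int.emod_lt_of_pos n hm'
    rw [← Int.emod_add_mul_ediv n (2 * m), ← hk]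
    set r := n % (2 * m)
    rcases le_or_gt r m with h | h
    · obtain ⟨s, hs⟩ := Int.eq_ofNat_of_zero_le hr0
      rw [hs]
      exact h0 s (by omega)
    · rw [hk r (-1), ← fcoeff_neg hg]
      obtain ⟨s, hs⟩ := Int.eq_ofNat_of_zero_le (a := -(r + 2 * m * (-1))) (by linarith)
      rw [hs]
      exact h0 s (by omega)

end

/-- The first `m + 1` Fourier coefficients, as a linear map. -/
def fcoeffMap (τ : ℍ) (m : ℕ) : evenTheta τ m →ₗ[ℂ] (Fin (m + 1) → ℂ) where
  toFun g i := fcoeff g i.1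
  map_add' f g := by
    funext i
    have hf := f.2.1.continuous
    have hg := g.2.1.continuous
    simp only [fcoeff, Submodule.coe_add, Pi.add_apply, add_mul]
    rw [intervalIntegral.integral_add] <;>
      exact Continuous.intervalIntegrable (by fun_prop) _ _
  map_smul' c f := by
    funext i
    simp [fcoeff, mul_assoc]

/-- `m + 1` linearly independent even theta functions of index `m` span the space of all of
them. -/
lemma mem_span_of_linearIndependent {τ : ℍ} {m : ℕ} {v : Fin (m + 1) → ℂ → ℂ}
    (hv : ∀ i, v i ∈ evenTheta τ m) (hli : LinearIndependent ℂ v) {g : ℂ → ℂ}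
    (hg : g ∈ evenTheta τ m) : g ∈ Submodule.span ℂ (Set.range v) := by
  have hinj : Function.Injective (fcoeffMap τ m) := by
    rw [← LinearMap.ker_eq_bot, LinearMap.ker_eq_bot']
    intro f hf
    refine Subtype.ext (eq_zero_of_fcoeff f.2 fun n hn ↦ ?_)
    exact congrFun hf ⟨n, Nat.lt_succ_of_le hn⟩
  have : FiniteDimensional ℂ (evenTheta τ m) := Module.Finite.of_injective _ hinj
  have hle := LinearMap.finrank_le_finrank_of_injective hinj
  rw [Module.finrank_fin_fun] at hle
  let v' : Fin (m + 1) → evenTheta τ m := fun i ↦ ⟨v i, hv i⟩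
  have hli' : LinearIndependent ℂ v' := LinearIndependent.of_comp (evenTheta τ m).subtype hli
  have hspan : Submodule.span ℂ (Set.range v') = ⊤ :=
    hli'.span_eq_top_of_card_eq_finrank' (le_antisymm (by simpa using hli'.fintype_card_le_finrank)
      (by simpa using hle))
  have hmem : (⟨g, hg⟩ : evenTheta τ m) ∈ Submodule.span ℂ (Set.range v') := hspan ▸ trivial
  have := Submodule.mem_map_of_mem (f := (evenTheta τ m).subtype) hmem
  rwa [Submodule.map_span, ← Set.range_comp] at this

/-! ### The theta constant `ϑ'(τ, 0)` -/

/-- A modular form of level one from a holomorphic function with the transformation law that is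
bounded at `i∞`. -/
def mkModularForm (k : ℤ) (f : ℍ → ℂ) (hd : ∀ τ : ℍ, DifferentiableAt ℂ (fun w ↦ f (ofComplex w)) τ)
    (hm : ∀ (γ : SL(2, ℤ)) τ, f (γ • τ) = autJ γ τ ^ k * f τ)
    (hb : UpperHalfPlane.IsBoundedAtImInfty f) : ModularForm 𝒮ℒ k :=
  have hslash (γ : SL(2, ℤ)) : SlashAction.map k γ f = f := by
    funext τ
    have := autJ_ne_zero γ τ
    rw [ModularForm.SL_slash_apply, hm, ModularGroup.denom_apply, zpow_neg]
    change autJ γ τ ^ k * f τ * (autJ γ τ ^ k)⁻¹ = f τ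
    field_simp
  { toFun := f
    slash_action_eq' := by
      rintro A ⟨γ, rfl⟩
      exact hslash γ
    holo' := by
      rw [UpperHalfPlane.mdifferentiable_iff]
      exact fun w hw ↦ (hd ⟨w, hw⟩).differentiableWithinAt
    bdd_at_cusps' := fun hc ↦ by
      rw [Subgroup.IsArithmetic.isCusp_iff_isCusp_SL2Z] at hc
      rw [OnePoint.isBoundedAt_iff_forall_SL2Z hc]
      intro γ _
      rw [hslash]
      exact hb }

lemma exists_const_of_weight_zero (f : ℍ → ℂ)
    (hd : ∀ τ : ℍ, DifferentiableAt ℂ (fun w ↦ f (ofComplex w)) τ)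
    (hm : ∀ (γ : SL(2, ℤ)) τ, f (γ • τ) = f τ) {c : ℂ}
    (hb : Tendsto f UpperHalfPlane.atImInfty (𝓝 c)) (τ : ℍ) : f τ = c := by
  obtain ⟨c', hc'⟩ := ModularFormClass.levelOne_weight_zero_const
    (mkModularForm 0 f hd (by simpa using hm) (hb.isBigO_one ℝ))
  have h : f = Function.const _ c' := hc'
  rw [h] at hb ⊢
  exact tendsto_nhds_unique tendsto_const_nhds hb

/-- The function `q ↦ ∏ (1 - q ^ (n + 1)) ^ (-6)` on the unit disc. -/
def invEulerSix (q : ℂ) : ℂ := ((∏' n : ℕ, (1 - q ^ (n + 1))) ^ 6)⁻¹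

lemma tprod_one_sub_pow_ne_zero {q : ℂ} (hq : ‖q‖ < 1) : ∏' n : ℕ, (1 - q ^ (n + 1)) ≠ 0 := by
  simp_rw [sub_eq_add_neg]
  refine tprod_one_add_ne_zero_of_summable (f := fun n ↦ -q ^ (n + 1)) (fun n h ↦ ?_) ?_
  · have h1 : q ^ (n + 1) = 1 := by linear_combination -h
    have h2 := congrArg norm h1
    rw [norm_pow, norm_one] at h2
    exact absurd h2 (pow_lt_one₀ (norm_nonneg q) hq n.succ_ne_zero).ne
  · simpa using (summable_nat_add_iff 1).mpr (summable_geometric_of_lt_one (norm_nonneg _) hq)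

lemma differentiableOn_invEulerSix : DifferentiableOn ℂ invEulerSix (Metric.ball 0 1) :=
  (ModularForm.differentiableOn_tprod_one_sub_pow.pow 6).inv fun _ hq ↦
    pow_ne_zero _ (tprod_one_sub_pow_ne_zero (by simpa using hq))

lemma norm_exp_two_pi_I_mul_lt_one (τ : ℍ) : ‖cexp (2 * π * I * τ)‖ < 1 := by
  simpa using UpperHalfPlane.norm_exp_two_pi_I_lt_one τ

/-- The `q`-expansion of a holomorphic function of `q` in the unit disc. -/
lemma isWeak_of_differentiableOn {f : ℂ → ℂ} (hf : DifferentiableOn ℂ f (Metric.ball 0 1)) :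
    IsWeak fun τ _ ↦ f (cexp (2 * π * I * τ)) := by
  have hinj : Function.Injective fun n : ℕ ↦ ((n, 0) : ℕ × ℤ) := fun _ _ h ↦ (Prod.mk.inj h).1
  refine ⟨fun p ↦ if p.2 = 0 then (p.1.factorial : ℂ)⁻¹ * iteratedDeriv p.1 f 0 else 0,
    fun x ↦ (hinj.hasSum_iff ?_).mp ?_⟩
  · rintro ⟨n, l⟩ hl
    have : l ≠ 0 := by rintro rfl; exact hl ⟨n, rfl⟩
    simp [this]
  · have := Complex.hasSum_taylorSeries_on_ball hf (z := cexp (2 * π * I * x.1))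
      (by simpa using norm_exp_two_pi_I_mul_lt_one x.1)
    refine (congrArg (HasSum · _) (funext fun n ↦ ?_)).mpr this
    simp only [Function.comp_apply, if_true, qz, sub_zero, smul_eq_mul, ← Complex.exp_nat_mul]
    push_cast
    ring_nf

/-- The function `q ^ (1/4) / η ^ 6`. -/
def invEta (τ : ℍ) : ℂ := invEulerSix (cexp (2 * π * I * τ))

lemma isWeak_invEta : IsWeak fun τ _ ↦ invEta τ :=
  isWeak_of_differentiableOn differentiableOn_invEulerSix

lemma tendsto_invEta : Tendsto invEta UpperHalfPlane.atImInfty (𝓝 1) := by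
  have h1 : ContinuousAt invEulerSix 0 := (differentiableOn_invEulerSix.differentiableAt
    (Metric.ball_mem_nhds 0 one_pos)).continuousAt
  have h2 : invEulerSix 0 = 1 := by simp [invEulerSix]
  rw [ContinuousAt, h2] at h1
  have h3 := UpperHalfPlane.qParam_tendsto_atImInfty zero_lt_one
  have := h1.comp h3
  refine this.congr fun τ ↦ ?_
  simp [invEta, Function.Periodic.qParam]

lemma invEta_eq (τ : ℍ) :
    invEta τ = cexp (2 * π * I * τ / 8) ^ 2 / ModularForm.eta τ ^ 6 := by
  have h : ModularForm.eta τ = cexp (2 * π * I * τ / 24) *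
      ∏' n : ℕ, (1 - cexp (2 * π * I * τ) ^ (n + 1)) := by
    simp [ModularForm.eta, ModularForm.eta_q, Function.Periodic.qParam]
  have h0 := tprod_one_sub_pow_ne_zero (norm_exp_two_pi_I_mul_lt_one τ)
  rw [invEta, invEulerSix, h, mul_pow, ← Complex.exp_nat_mul, ← Complex.exp_nat_mul,
    eq_div_iff (mul_ne_zero (Complex.exp_ne_zero _) (pow_ne_zero _ h0)), mul_comm,
    mul_assoc, mul_inv_cancel₀ (pow_ne_zero _ h0), mul_one]
  push_cast
  ring_nf

/-- The operator `f ↦ e ^ (-πiz) d/dz (e ^ (πiz) f)`. -/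
def twistDeriv (F : ℍ → ℂ → ℂ) (τ : ℍ) (z : ℂ) : ℂ := π * I * F τ z + deriv (F τ) z

lemma IsWeak.twistDeriv {F : ℍ → ℂ → ℂ} (hF : IsWeak F) : IsWeak (twistDeriv F) :=
  (hF.const_mul _).add hF.deriv

lemma deriv_exp_mul {F : ℍ → ℂ → ℂ} (hF : IsWeak F) (τ : ℍ) (c : ℂ) :
    deriv (fun z ↦ c * (cexp (π * I * z) * F τ z)) =
      fun z ↦ c * (cexp (π * I * z) * twistDeriv F τ z) := by
  funext z
  have h1 : HasDerivAt (fun z : ℂ ↦ cexp (π * I * z)) (cexp (π * I * z) * (π * I)) z := by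
    simpa using ((hasDerivAt_id z).const_mul (π * I : ℂ)).cexp
  have h2 := ((h1.mul (hF.differentiable τ z).hasDerivAt).const_mul c).deriv
  rw [show (fun z ↦ c * (cexp (π * I * z) * F τ z)) =
    fun z ↦ c * ((fun z : ℂ ↦ cexp (π * I * z)) * F τ) z from rfl, h2, WeakJacobi.twistDeriv]
  ring

lemma deriv_theta (τ : ℍ) : deriv (theta τ) =
    fun z ↦ cexp (2 * π * I * τ / 8) * (cexp (π * I * z) * twistDeriv thetaSeries τ z) := by
  rw [← deriv_exp_mul isWeak_thetaSeries]
  exact congrArg deriv (funext (theta_eq τ))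

/-- The limits of the derivatives of `thetaSeries` as `Im τ → ∞`: only the terms `1` and `-ζ⁻¹`
remain. -/
lemma tendsto_iterate_deriv_thetaSeries (j : ℕ) (z : ℂ) :
    Tendsto (fun τ ↦ deriv^[j] (thetaSeries τ) z) UpperHalfPlane.atImInfty
      (𝓝 (0 ^ j - (-(2 * π * I)) ^ j * cexp (-(2 * π * I * z)))) := by
  have h (j : ℕ) : ∀ x : ℍ × ℂ, HasSum (fun p : ℕ × ℤ ↦ (2 * π * I * p.2) ^ j * thetaCoeff p * qz p x)
      (deriv^[j] (thetaSeries x.1) x.2) := by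
    induction j with
    | zero => simpa using hasSum_thetaSeries
    | succ j ih =>
      have := hasSum_deriv (F := fun τ ↦ deriv^[j] (thetaSeries τ)) ih
      simpa only [Function.iterate_succ', pow_succ', Function.comp_apply, mul_assoc] using this
  have ht := tendsto_of_hasSum (F := fun τ ↦ deriv^[j] (thetaSeries τ)) (h j) z
  convert ht using 2
  rw [tsum_eq_sum (s := {0, -1})]
  · rw [Finset.sum_pair (by norm_num)]
    simp [thetaCoeff]
    ring
  · intro l hl
    have : ¬ (0 = l * (l + 1)) := by
      intro h0
      rcases mul_eq_zero.mp h0.symm with h0 | h0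
      · simp [h0] at hl
      · simp [show l = -1 by omega] at hl
    simp [thetaCoeff, this]

lemma tendsto_phiNeg2_div (τ : ℍ) : Tendsto (fun z ↦ phiNeg2 τ z / z ^ 2) (𝓝[≠] 0)
    (𝓝 (deriv (theta τ) 0 ^ 2 / ModularForm.eta τ ^ 6)) := by
  have h1 := (differentiable_theta τ 0).hasDerivAt.tendsto_slope
  refine ((h1.pow 2).div_const (ModularForm.eta τ ^ 6)).congr fun z ↦ ?_
  simp only [slope_def_field, theta_zero, sub_zero, phiNeg2]
  ring

/-- `ϑ'(τ, 0) ^ 2 / η ^ 6` is a modular form of weight zero, hence constant. -/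
lemma deriv_theta_zero_sq (τ : ℍ) :
    deriv (theta τ) 0 ^ 2 / ModularForm.eta τ ^ 6 = -(4 * π ^ 2) := by
  have hexp (τ : ℍ) : deriv (theta τ) 0 ^ 2 / ModularForm.eta τ ^ 6 =
      twistDeriv thetaSeries τ 0 ^ 2 * invEta τ := by
    rw [deriv_theta, invEta_eq]
    simp only [mul_zero, Complex.exp_zero]
    ring
  have hw : IsWeak fun τ _ ↦ deriv (theta τ) 0 ^ 2 / ModularForm.eta τ ^ 6 := by
    have := isWeak_thetaSeries.twistDeriv.eval 0
    have := (this.mul this).mul isWeak_invEta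
    simpa only [hexp, ← sq] using this
  refine exists_const_of_weight_zero (fun τ ↦ deriv (theta τ) 0 ^ 2 / ModularForm.eta τ ^ 6)
    (fun τ ↦ hw.differentiableAt_left τ 0) (fun γ τ ↦ ?_) ?_ τ
  · have hJ := autJ_ne_zero γ τ
    have h1 : Tendsto (fun z ↦ z / autJ γ τ) (𝓝[≠] 0) (𝓝[≠] 0) := by
      refine tendsto_nhdsWithin_iff.mpr ⟨?_, ?_⟩
      · have : Continuous fun z : ℂ ↦ z / autJ γ τ := by fun_prop
        simpa using (this.tendsto 0).mono_left nhdsWithin_le_nhds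
      · filter_upwards [self_mem_nhdsWithin] with z hz
        exact div_ne_zero hz hJ
    have h2 := (tendsto_phiNeg2_div (γ • τ)).comp h1
    have h3 : Tendsto (fun z : ℂ ↦ cexp (2 * π * I * ((γ 1 0 : ℂ) * z ^ 2 / autJ γ τ)))
        (𝓝[≠] 0) (𝓝 1) := by
      have : Continuous fun z : ℂ ↦ cexp (2 * π * I * ((γ 1 0 : ℂ) * z ^ 2 / autJ γ τ)) := by
        fun_prop
      simpa using (this.tendsto 0).mono_left nhdsWithin_le_nhds
    have h4 := h3.mul (tendsto_phiNeg2_div τ)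
    rw [one_mul] at h4
    refine tendsto_nhds_unique (h2.congr' ?_) h4
    filter_upwards [self_mem_nhdsWithin] with z hz
    have hz' : z ≠ 0 := hz
    rw [Function.comp_apply, isModular_phiNeg2 γ τ z, zpow_neg]
    field_simp
  · have h0 := tendsto_iterate_deriv_thetaSeries 0 0
    have h1 := tendsto_iterate_deriv_thetaSeries 1 0
    simp only [Function.iterate_zero, id, Function.iterate_one] at h0 h1
    have := (((h0.const_mul (π * I : ℂ)).add h1).pow 2).mul tendsto_invEta
    refine (this.congr fun τ ↦ (hexp τ).symm).trans (le_of_eq ?_)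
    congr 1
    simp
    ring_nf
    simp

lemma deriv_theta_zero_ne_zero (τ : ℍ) : deriv (theta τ) 0 ≠ 0 := by
  intro h
  have := deriv_theta_zero_sq τ
  simp [h, Real.pi_ne_zero] at this

/-! ### The product of the Weierstrass function and the square of the theta function -/

lemma mem_lattice_iff {τ : ℍ} {z : ℂ} :
    z ∈ (periodPair τ).lattice ↔ ∃ m n : ℤ, (m : ℂ) + n * τ = z := by
  simp [PeriodPair.mem_lattice, periodPair]

lemma one_mem_lattice (τ : ℍ) : (1 : ℂ) ∈ (periodPair τ).lattice := (periodPair τ).ω₁_mem_lattice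

lemma tau_mem_lattice (τ : ℍ) : (τ : ℂ) ∈ (periodPair τ).lattice := (periodPair τ).ω₂_mem_lattice

lemma theta_eq_zero {τ : ℍ} {z : ℂ} (hz : z ∈ (periodPair τ).lattice) : theta τ z = 0 := by
  have h1 (z : ℂ) : theta τ (z + 1) = 0 ↔ theta τ z = 0 := by rw [theta_add_one, neg_eq_zero]
  have h2 (z : ℂ) : theta τ (z + τ) = 0 ↔ theta τ z = 0 := by
    rw [theta_add_tau, neg_eq_zero, mul_eq_zero, or_iff_right (Complex.exp_ne_zero _)]
  obtain ⟨m, n, rfl⟩ := mem_lattice_iff.mp hz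
  have h3 : theta τ (n * τ) = 0 := by
    induction n using Int.induction_on with
    | zero => simp
    | succ n ih =>
      rw [← h2] at ih
      rw [← ih (mem_lattice_iff.mpr ⟨m, n, rfl⟩)]
      push_cast
      ring_nf
    | pred n ih =>
      rw [← h2, ← ih (mem_lattice_iff.mpr ⟨m, _, rfl⟩)]
      push_cast
      ring_nf
  clear hz
  induction m using Int.induction_on with
  | zero => simpa using h3
  | succ m ih =>
    rw [← h1] at ih
    rw [← ih]
    push_cast
    ring_nf
  | pred m ih =>
    rw [← h1, ← ih]
    push_cast
    ring_nf

lemma dense_compl_lattice (τ : ℍ) : Dense ((periodPair τ).lattice : Set ℂ)ᶜ := by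
  have : Countable (periodPair τ).lattice :=
    (periodPair τ).latticeEquivProd.injective.countable
  exact (Set.to_countable ((periodPair τ).lattice : Set ℂ)).dense_compl ℂ

lemma eq_of_eq_off_lattice {τ : ℍ} {f g : ℂ → ℂ} (hf : Continuous f) (hg : Continuous g)
    (h : ∀ z ∉ (periodPair τ).lattice, f z = g z) : f = g :=
  hf.ext_on (dense_compl_lattice τ) hg h

lemma eventually_notMem_lattice (τ : ℍ) (z : ℂ) :
    ∀ᶠ w in 𝓝[≠] z, w ∉ (periodPair τ).lattice := by
  filter_upwards [mem_nhdsWithin_of_mem_nhds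
    ((periodPair τ).compl_lattice_sdiff_singleton_mem_nhds z), self_mem_nhdsWithin] with w h1 h2 h3
  exact h1 ⟨h3, h2⟩

open Classical in
/-- The entire function `℘ ϑ ^ 2`; its value `ϑ' ^ 2` at the lattice points is the limit. -/
def wpTheta (τ : ℍ) (z : ℂ) : ℂ :=
  if z ∈ (periodPair τ).lattice then deriv (theta τ) z ^ 2
  else (periodPair τ).weierstrassP z * theta τ z ^ 2

lemma wpTheta_of_notMem {τ : ℍ} {z : ℂ} (hz : z ∉ (periodPair τ).lattice) :
    wpTheta τ z = (periodPair τ).weierstrassP z * theta τ z ^ 2 := if_neg hz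

lemma wpTheta_of_mem {τ : ℍ} {z : ℂ} (hz : z ∈ (periodPair τ).lattice) :
    wpTheta τ z = deriv (theta τ) z ^ 2 := if_pos hz

lemma wpTheta_eq_near {τ : ℍ} {l : ℂ} (hl : l ∈ (periodPair τ).lattice) {w : ℂ}
    (hw : w ∈ (((periodPair τ).lattice : Set ℂ) \ {l})ᶜ) : wpTheta τ w =
      ((periodPair τ).weierstrassPExcept l w - 1 / l ^ 2) * theta τ w ^ 2 +
        dslope (theta τ) l w ^ 2 := by
  rcases eq_or_ne w l with rfl | hne
  · rw [wpTheta_of_mem hl, theta_eq_zero hl, dslope_same]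
    ring
  · have hw' : w ∉ (periodPair τ).lattice := fun h ↦ hw ⟨h, hne⟩
    rw [wpTheta_of_notMem hw', dslope_of_ne _ hne, slope_def_field, theta_eq_zero hl,
      ← (periodPair τ).weierstrassPExcept_add ⟨l, hl⟩]
    have := sub_ne_zero.mpr hne
    field_simp
    ring

lemma differentiable_dslope_theta (τ : ℍ) (l : ℂ) : Differentiable ℂ (dslope (theta τ) l) := by
  rw [← differentiableOn_univ]
  exact (Complex.differentiableOn_dslope univ_mem).mpr (differentiable_theta τ).differentiableOn

lemma differentiable_wpTheta (τ : ℍ) : Differentiable ℂ (wpTheta τ) := by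
  intro z
  by_cases hz : z ∈ (periodPair τ).lattice
  · have h1 := (periodPair τ).compl_lattice_sdiff_singleton_mem_nhds z
    have h2 : DifferentiableAt ℂ ((periodPair τ).weierstrassPExcept z) z :=
      ((periodPair τ).analyticAt_weierstrassPExcept z).differentiableAt
    have h3 := differentiable_theta τ z
    have h4 := differentiable_dslope_theta τ z z
    refine DifferentiableAt.congr_of_eventuallyEq (f := fun w ↦
      ((periodPair τ).weierstrassPExcept z w - 1 / z ^ 2) * theta τ w ^ 2 +
        dslope (theta τ) z w ^ 2) (by fun_prop) ?_
    filter_upwards [h1] with w hw using wpTheta_eq_near hz hw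
  · have h1 := (periodPair τ).isClosed_lattice.isOpen_compl.mem_nhds hz
    have h2 := (periodPair τ).differentiableOn_weierstrassP.differentiableAt h1
    have h3 := differentiable_theta τ z
    refine DifferentiableAt.congr_of_eventuallyEq (f := fun w ↦
      (periodPair τ).weierstrassP w * theta τ w ^ 2) (by fun_prop) ?_
    filter_upwards [h1] with w hw using wpTheta_of_notMem hw

lemma phiZero_eq (τ : ℍ) (z : ℂ) :
    phiZero τ z = -(3 / (π : ℂ) ^ 2) * (wpTheta τ z / ModularForm.eta τ ^ 6) := by
  refine Tendsto.limUnder_eq ?_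
  have hc := (differentiable_wpTheta τ).continuous
  have : Continuous fun z ↦ -(3 / (π : ℂ) ^ 2) * (wpTheta τ z / ModularForm.eta τ ^ 6) := by
    fun_prop
  refine ((this.tendsto z).mono_left nhdsWithin_le_nhds).congr' ?_
  filter_upwards [eventually_notMem_lattice τ z] with w hw
  rw [wpTheta_of_notMem hw, phiNeg2]
  ring

lemma phiZero_of_notMem {τ : ℍ} {z : ℂ} (hz : z ∉ (periodPair τ).lattice) :
    phiZero τ z = -(3 / (π : ℂ) ^ 2) * (periodPair τ).weierstrassP z * phiNeg2 τ z := by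
  rw [phiZero_eq, wpTheta_of_notMem hz, phiNeg2]
  ring

lemma theta_sq_mem_evenTheta (τ : ℍ) : (fun z ↦ theta τ z ^ 2) ∈ evenTheta τ 1 := by
  refine ⟨(differentiable_theta τ).pow 2, fun z ↦ by simp [theta_neg],
    fun z ↦ by simp [theta_add_one], fun z ↦ ?_⟩
  simp only [theta_add_tau, neg_sq, mul_pow, ← Complex.exp_nat_mul]
  push_cast
  ring_nf

lemma wpTheta_mem_evenTheta (τ : ℍ) : wpTheta τ ∈ evenTheta τ 1 := by
  have hd := differentiable_wpTheta τ
  have hc := hd.continuous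
  obtain ⟨-, k2, k3, k4⟩ := theta_sq_mem_evenTheta τ
  beta_reduce at k2 k3 k4
  refine ⟨hd, congrFun (eq_of_eq_off_lattice (τ := τ) (by fun_prop) hc fun z hz ↦ ?_),
    congrFun (eq_of_eq_off_lattice (τ := τ) (by fun_prop) hc fun z hz ↦ ?_),
    congrFun (eq_of_eq_off_lattice (τ := τ) (by fun_prop) (by fun_prop) fun z hz ↦ ?_)⟩
  · rw [wpTheta_of_notMem hz, wpTheta_of_notMem (by simpa using hz), k2,
      (periodPair τ).weierstrassP_neg]
  · have h : z + 1 ∉ (periodPair τ).lattice := by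
      rwa [Submodule.add_mem_iff_left _ (one_mem_lattice τ)]
    rw [wpTheta_of_notMem hz, wpTheta_of_notMem h, k3,
      (periodPair τ).weierstrassP_add_coe z ⟨1, one_mem_lattice τ⟩]
  · have h : z + τ ∉ (periodPair τ).lattice := by
      rwa [Submodule.add_mem_iff_left _ (tau_mem_lattice τ)]
    rw [wpTheta_of_notMem hz, wpTheta_of_notMem h, k4,
      (periodPair τ).weierstrassP_add_coe z ⟨τ, tau_mem_lattice τ⟩]
    ring

lemma phiNeg2_mem_evenTheta (τ : ℍ) : phiNeg2 τ ∈ evenTheta τ 1 := by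
  convert (evenTheta τ 1).smul_mem (ModularForm.eta τ ^ 6)⁻¹ (theta_sq_mem_evenTheta τ) using 1
  funext z
  simp [phiNeg2, div_eq_inv_mul]

lemma phiZero_mem_evenTheta (τ : ℍ) : phiZero τ ∈ evenTheta τ 1 := by
  convert (evenTheta τ 1).smul_mem (-(3 / (π : ℂ) ^ 2) * (ModularForm.eta τ ^ 6)⁻¹)
    (wpTheta_mem_evenTheta τ) using 1
  funext z
  rw [phiZero_eq, Pi.smul_apply, smul_eq_mul]
  ring

@[simp] lemma phiNeg2_zero (τ : ℍ) : phiNeg2 τ 0 = 0 := by simp [phiNeg2]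

lemma phiZero_zero (τ : ℍ) : phiZero τ 0 = 12 := by
  rw [phiZero_eq, wpTheta_of_mem (zero_mem _), deriv_theta_zero_sq]
  have : (π : ℂ) ≠ 0 := by exact_mod_cast Real.pi_ne_zero
  field_simp
  norm_num

lemma eventually_theta_ne_zero (τ : ℍ) : ∀ᶠ z in 𝓝[≠] 0, theta τ z ≠ 0 := by
  have := (differentiable_theta τ 0).hasDerivAt.eventually_ne (c := 0) (deriv_theta_zero_ne_zero τ)
  exact this

lemma eventually_phiNeg2_ne_zero (τ : ℍ) : ∀ᶠ z in 𝓝[≠] 0, phiNeg2 τ z ≠ 0 := by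
  filter_upwards [eventually_theta_ne_zero τ] with z hz
  exact div_ne_zero (pow_ne_zero 2 hz) (pow_ne_zero 6 (eta_ne_zero τ))

/-! ### Modularity of `φ_{0,1}` -/

lemma autJ_mul_mem_lattice {γ : SL(2, ℤ)} {τ : ℍ} {w : ℂ} (hw : w ∈ (periodPair (γ • τ)).lattice) :
    autJ γ τ * w ∈ (periodPair τ).lattice := by
  obtain ⟨m, n, rfl⟩ := mem_lattice_iff.mp hw
  refine mem_lattice_iff.mpr ⟨m * γ 1 1 + n * γ 0 1, m * γ 1 0 + n * γ 0 0, ?_⟩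
  have := coe_smul_mul_autJ γ τ
  have hJ : autJ γ τ = (γ 1 0 : ℂ) * τ + (γ 1 1 : ℂ) := rfl
  push_cast
  linear_combination (-(n : ℂ)) * this + (-(m : ℂ)) * hJ

lemma autJ_mul_mem_lattice_iff {γ : SL(2, ℤ)} {τ : ℍ} {w : ℂ} :
    autJ γ τ * w ∈ (periodPair τ).lattice ↔ w ∈ (periodPair (γ • τ)).lattice := by
  refine ⟨fun h ↦ ?_, autJ_mul_mem_lattice⟩
  have h1 := autJ_mul γ⁻¹ γ τ
  rw [inv_mul_cancel, show autJ (1 : SL(2, ℤ)) τ = 1 by simp [autJ]] at h1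
  have h2 := autJ_mul_mem_lattice (γ := γ⁻¹) (τ := γ • τ) (w := autJ γ τ * w) (by simpa using h)
  rwa [← mul_assoc, ← h1, one_mul] at h2

lemma weierstrassP_smul (γ : SL(2, ℤ)) (τ : ℍ) (z : ℂ) :
    (periodPair (γ • τ)).weierstrassP (z / autJ γ τ) =
      autJ γ τ ^ 2 * (periodPair τ).weierstrassP z := by
  have hJ := autJ_ne_zero γ τ
  let e : (periodPair (γ • τ)).lattice ≃ (periodPair τ).lattice :=
    (Equiv.mulLeft₀ (autJ γ τ) hJ).subtypeEquiv fun w ↦ autJ_mul_mem_lattice_iff.symm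
  rw [PeriodPair.weierstrassP, PeriodPair.weierstrassP, ← e.tsum_eq, ← tsum_mul_left]
  refine tsum_congr fun l ↦ ?_
  have he : ((e l : (periodPair τ).lattice) : ℂ) = autJ γ τ * l := rfl
  rw [he]
  have h1 : z - autJ γ τ * l = autJ γ τ * (z / autJ γ τ - l) := by field_simp
  rw [h1, mul_sub, mul_pow, mul_pow, one_div, one_div, one_div, one_div, mul_inv, mul_inv,
    mul_inv_cancel_left₀ (pow_ne_zero 2 hJ), mul_inv_cancel_left₀ (pow_ne_zero 2 hJ)]

lemma isModular_phiZero : IsModular 0 phiZero := by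
  intro γ τ
  have hJ := autJ_ne_zero γ τ
  have h1 := (phiZero_mem_evenTheta τ).1.continuous
  have h2 := (phiZero_mem_evenTheta (γ • τ)).1.continuous
  refine congrFun (eq_of_eq_off_lattice (τ := τ) (by fun_prop) (by fun_prop) fun z hz ↦ ?_)
  have hz' : z / autJ γ τ ∉ (periodPair (γ • τ)).lattice := by
    rwa [← autJ_mul_mem_lattice_iff, mul_div_cancel₀ _ hJ]
  rw [phiZero_of_notMem hz, phiZero_of_notMem hz', weierstrassP_smul, isModular_phiNeg2 γ τ z,
    zpow_neg, zpow_zero]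
  field_simp

/-! ### The Fourier expansion of `φ_{0,1}` -/

/-- The quantity `f' ^ 2 - f f'' = -f ^ 2 (log f)''`. -/
def logHess (f : ℂ → ℂ) (z : ℂ) : ℂ := deriv f z ^ 2 - f z * deriv (deriv f) z

lemma logHess_theta_mem_evenTheta (τ : ℍ) : logHess (theta τ) ∈ evenTheta τ 1 := by
  have hθ := differentiable_theta τ
  have hθ' : Differentiable ℂ (deriv (theta τ)) := hθ.deriv
  have hθ'' : Differentiable ℂ (deriv (deriv (theta τ))) := hθ'.deriv
  refine ⟨(hθ'.pow 2).sub (hθ.mul hθ''), fun z ↦ ?_, fun z ↦ ?_, fun z ↦ ?_⟩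
  · have e0 : theta τ = fun z ↦ -theta τ (-z) := by funext z; rw [theta_neg, neg_neg]
    have e1 : deriv (theta τ) = fun z ↦ deriv (theta τ) (-z) := by
      funext z
      conv_lhs => rw [e0]
      rw [deriv.fun_neg, deriv_comp_neg, neg_neg]
    have e2 : deriv (deriv (theta τ)) z = -deriv (deriv (theta τ)) (-z) := by
      conv_lhs => rw [e1]
      rw [deriv_comp_neg]
    rw [logHess, logHess, theta_neg, e2, congrFun e1 z]
    ring
  · have e0 : theta τ = fun z ↦ -theta τ (z + 1) := by funext z; rw [theta_add_one, neg_neg]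
    have e1 : deriv (theta τ) = fun z ↦ -deriv (theta τ) (z + 1) := by
      funext z
      conv_lhs => rw [e0]
      rw [deriv.fun_neg, deriv_comp_add_const]
    have e2 : deriv (deriv (theta τ)) z = -deriv (deriv (theta τ)) (z + 1) := by
      conv_lhs => rw [e1]
      rw [deriv.fun_neg, deriv_comp_add_const]
    rw [logHess, logHess, theta_add_one, e2, congrFun e1 z]
    ring
  · let g : ℂ → ℂ := fun z ↦ -cexp (-(π * I * τ) - 2 * π * I * z)
    have hg (z : ℂ) : HasDerivAt g (-(2 * π * I) * g z) z := by
      have : HasDerivAt (fun z : ℂ ↦ -(π * I * τ) - 2 * π * I * z) (-(2 * π * I)) z := by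
        simpa using ((hasDerivAt_id z).const_mul (2 * π * I : ℂ)).const_sub (-(π * I * τ) : ℂ)
      refine this.cexp.neg.congr_deriv ?_
      simp only [g]
      ring
    have e0 : (fun z ↦ theta τ (z + τ)) = fun z ↦ g z * theta τ z := by
      funext z
      rw [theta_add_tau]
      simp only [g]
      ring
    have e1 : (fun z ↦ deriv (theta τ) (z + τ)) =
        fun z ↦ g z * (deriv (theta τ) z - 2 * π * I * theta τ z) := by
      funext z
      rw [← deriv_comp_add_const, e0, ((hg z).fun_mul (hθ z).hasDerivAt).deriv]
      ring
    have e2 : deriv (deriv (theta τ)) (z + τ) = g z * (deriv (deriv (theta τ)) z -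
        2 * (2 * π * I) * deriv (theta τ) z + (2 * π * I) ^ 2 * theta τ z) := by
      rw [← deriv_comp_add_const, e1, ((hg z).fun_mul ((hθ' z).hasDerivAt.fun_sub
        ((hθ z).hasDerivAt.const_mul (2 * π * I)))).deriv]
      ring
    have hg2 : cexp (-(4 * π * I * (1 : ℕ) * z) - 2 * π * I * (1 : ℕ) * τ) = g z ^ 2 := by
      simp only [g, neg_sq, ← Complex.exp_nat_mul]
      push_cast
      ring_nf
    rw [logHess, logHess, congrFun e0 z, congrFun e1 z, e2, hg2]
    ring

/-- The space of even theta functions of index `1` is spanned by `ϑ ^ 2` and `℘ ϑ ^ 2`, and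
comparison of Taylor coefficients at `0` gives `℘ = -(log ϑ)'' + ϑ''' (0) / (3 ϑ' (0))`. -/
lemma wpTheta_eq (τ : ℍ) (z : ℂ) : wpTheta τ z = logHess (theta τ) z +
    deriv (deriv (deriv (theta τ))) 0 / (3 * deriv (theta τ) 0) * theta τ z ^ 2 := by
  have hθ0 := deriv_theta_zero_ne_zero τ
  have hw0 : wpTheta τ 0 = deriv (theta τ) 0 ^ 2 := wpTheta_of_mem (zero_mem _)
  have hli : LinearIndependent ℂ ![fun z ↦ theta τ z ^ 2, wpTheta τ] := by
    rw [LinearIndependent.pair_iff]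
    intro s t hst
    have ht : t = 0 := by
      have := congrFun hst 0
      simpa [hw0, hθ0] using this
    refine ⟨?_, ht⟩
    obtain ⟨z, hz⟩ := (eventually_theta_ne_zero τ).exists
    have := congrFun hst z
    simpa [ht, hz] using this
  have hmem := mem_span_of_linearIndependent (τ := τ) (m := 1)
    (v := ![fun z ↦ theta τ z ^ 2, wpTheta τ])
    (fun i ↦ by fin_cases i; exacts [theta_sq_mem_evenTheta τ, wpTheta_mem_evenTheta τ]) hli
    (logHess_theta_mem_evenTheta τ)
  rw [Matrix.range_cons_cons_empty, Submodule.mem_span_pair] at hmem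
  obtain ⟨a, b, hab⟩ := hmem
  have hab' (z : ℂ) : a * theta τ z ^ 2 + b * wpTheta τ z = logHess (theta τ) z := congrFun hab z
  have hb : b = 1 := by
    have := hab' 0
    rw [hw0, logHess, theta_zero] at this
    have h2 : (b - 1) * deriv (theta τ) 0 ^ 2 = 0 := by linear_combination this
    rcases mul_eq_zero.mp h2 with h | h
    · linear_combination h
    · exact absurd h (pow_ne_zero 2 hθ0)
  subst hb
  -- Taylor expansion at `0`, through `ϑ = z u`
  set u := dslope (theta τ) 0 with hu_def
  have hu : Differentiable ℂ u := differentiable_dslope_theta τ 0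
  have hu' : Differentiable ℂ (deriv u) := hu.deriv
  have hu'' : Differentiable ℂ (deriv (deriv u)) := hu'.deriv
  have f0 (z : ℂ) : theta τ z = z * u z := by
    have := sub_smul_dslope (theta τ) 0 z
    simp only [sub_zero, theta_zero, smul_eq_mul] at this
    exact this.symm
  have f1 (z : ℂ) : deriv (theta τ) z = u z + z * deriv u z := by
    rw [funext f0, ((hasDerivAt_id' z).fun_mul (hu z).hasDerivAt).deriv, one_mul]
  have f2 (z : ℂ) : deriv (deriv (theta τ)) z = 2 * deriv u z + z * deriv (deriv u) z := by
    rw [funext f1, ((hu z).hasDerivAt.fun_add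
      ((hasDerivAt_id' z).fun_mul (hu' z).hasDerivAt)).deriv]
    ring
  have f3 : deriv (deriv (deriv (theta τ))) 0 = 3 * deriv (deriv u) 0 := by
    rw [funext f2, (((hu' 0).hasDerivAt.const_mul 2).fun_add
      ((hasDerivAt_id' 0).fun_mul (hu'' 0).hasDerivAt)).deriv]
    ring
  have hu0 : u 0 = deriv (theta τ) 0 := by simp [f1]
  have hu1 : deriv u 0 = 0 := by
    have heven : u = fun z ↦ u (-z) := by
      funext z
      rcases eq_or_ne z 0 with rfl | hz
      · simp
      · have := theta_neg τ z
        rw [f0, f0] at this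
        refine mul_left_cancel₀ hz ?_
        linear_combination this
    have h : deriv u 0 = -deriv u 0 := by
      conv_lhs => rw [heven, deriv_comp_neg, neg_zero]
    linear_combination h / 2
  let P := (periodPair τ).weierstrassPExcept 0
  have hP : ContinuousAt P 0 := ((periodPair τ).analyticAt_weierstrassPExcept 0).continuousAt
  have hP0 : P 0 = 0 := (periodPair τ).weierstrassPExcept_zero 0
  let lhs : ℂ → ℂ := fun z ↦ deriv u z ^ 2 - u z * deriv (deriv u) z - P z * u z ^ 2
  have hlim1 : Tendsto lhs (𝓝[≠] 0) (𝓝 (-(u 0 * deriv (deriv u) 0))) := by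
    have : ContinuousAt lhs 0 := by
      have c0 := hu.continuous.continuousAt (x := 0)
      have c1 := hu'.continuous.continuousAt (x := 0)
      have c2 := hu''.continuous.continuousAt (x := 0)
      exact ((c1.pow 2).sub (c0.mul c2)).sub (hP.mul (c0.pow 2))
    have e : lhs 0 = -(u 0 * deriv (deriv u) 0) := by simp [lhs, hu1, hP0]
    rw [← e]
    exact this.tendsto.mono_left nhdsWithin_le_nhds
  have hlim2 : Tendsto lhs (𝓝[≠] 0) (𝓝 (a * u 0 ^ 2)) := by
    have : Continuous fun z ↦ a * u z ^ 2 := by have := hu.continuous; fun_prop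
    refine ((this.tendsto 0).mono_left nhdsWithin_le_nhds).congr' ?_
    filter_upwards [self_mem_nhdsWithin, mem_nhdsWithin_of_mem_nhds
      ((periodPair τ).compl_lattice_sdiff_singleton_mem_nhds 0)] with z hz hz'
    have hz0 : z ≠ 0 := hz
    have h := hab' z
    rw [wpTheta_eq_near (zero_mem _) hz', ← hu_def, logHess, f0, f1, f2] at h
    refine mul_left_cancel₀ (pow_ne_zero 2 hz0) ?_
    simp only [lhs, P]
    simp at h
    linear_combination h
  have ha := tendsto_nhds_unique hlim1 hlim2
  have hu0' : u 0 ≠ 0 := hu0 ▸ hθ0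
  have ha' : a = -(deriv (deriv u) 0 / u 0) := by
    field_simp
    refine mul_left_cancel₀ hu0' ?_
    linear_combination -ha
  rw [f3, ← hu0, ← hab' z, ha']
  field_simp
  ring

/-- The coefficient `ϑ''' (0) / (3 ϑ' (0))`, in a form without denominators. -/
def thetaConst (τ : ℍ) : ℂ :=
  -(1 / (12 * π ^ 2)) * (twistDeriv (twistDeriv (twistDeriv thetaSeries)) τ 0 *
    twistDeriv thetaSeries τ 0 * invEta τ)

lemma isWeak_thetaConst : IsWeak fun τ _ ↦ thetaConst τ :=
  (((isWeak_thetaSeries.twistDeriv.twistDeriv.twistDeriv.eval 0).mul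
    (isWeak_thetaSeries.twistDeriv.eval 0)).mul isWeak_invEta).const_mul _

lemma phiNeg2_eq (τ : ℍ) (z : ℂ) :
    phiNeg2 τ z = cexp (2 * π * I * z) * thetaSeries τ z ^ 2 * invEta τ := by
  rw [phiNeg2, theta_eq, invEta_eq, show (2 * π * I * z : ℂ) = (2 : ℕ) * (π * I * z) by
    push_cast; ring, Complex.exp_nat_mul _ 2]
  ring

lemma phiZero_eq_expansion (τ : ℍ) (z : ℂ) :
    phiZero τ z = -(3 / (π : ℂ) ^ 2) * (cexp (2 * π * I * z) * (deriv (thetaSeries τ) z ^ 2 -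
      thetaSeries τ z * deriv (deriv (thetaSeries τ)) z) * invEta τ +
        thetaConst τ * phiNeg2 τ z) := by
  have hw := isWeak_thetaSeries
  have hη : ModularForm.eta τ ^ 6 ≠ 0 := pow_ne_zero 6 (eta_ne_zero τ)
  have hπ : (π : ℂ) ≠ 0 := by exact_mod_cast Real.pi_ne_zero
  have d1 := deriv_theta τ
  have d2 : deriv (deriv (theta τ)) = fun z ↦ cexp (2 * π * I * τ / 8) *
      (cexp (π * I * z) * twistDeriv (twistDeriv thetaSeries) τ z) := by
    rw [d1, deriv_exp_mul hw.twistDeriv]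
  have d3 : deriv (deriv (deriv (theta τ))) = fun z ↦ cexp (2 * π * I * τ / 8) *
      (cexp (π * I * z) * twistDeriv (twistDeriv (twistDeriv thetaSeries)) τ z) := by
    rw [d2, deriv_exp_mul hw.twistDeriv.twistDeriv]
  have t2 : twistDeriv (twistDeriv thetaSeries) τ z = (π * I) ^ 2 * thetaSeries τ z +
      2 * (π * I) * deriv (thetaSeries τ) z + deriv (deriv (thetaSeries τ)) z := by
    have h : deriv (twistDeriv thetaSeries τ) z =
        π * I * deriv (thetaSeries τ) z + deriv (deriv (thetaSeries τ)) z :=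
      (((hw.differentiable τ z).hasDerivAt.const_mul (π * I : ℂ)).fun_add
        (hw.deriv.differentiable τ z).hasDerivAt).deriv
    rw [twistDeriv, h, twistDeriv]
    ring
  have hL : logHess (theta τ) z / ModularForm.eta τ ^ 6 = cexp (2 * π * I * z) *
      (deriv (thetaSeries τ) z ^ 2 - thetaSeries τ z * deriv (deriv (thetaSeries τ)) z) *
        invEta τ := by
    rw [logHess, d2, d1]
    beta_reduce
    rw [theta_eq, t2, twistDeriv, invEta_eq,
      show (2 * π * I * z : ℂ) = (2 : ℕ) * (π * I * z) by push_cast; ring,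
      Complex.exp_nat_mul _ 2]
    ring
  have hC : deriv (deriv (deriv (theta τ))) 0 / (3 * deriv (theta τ) 0) = thetaConst τ := by
    have h0 := deriv_theta_zero_ne_zero τ
    have h1 := deriv_theta_zero_sq τ
    rw [div_eq_iff hη] at h1
    have e : thetaConst τ = -(1 / (12 * π ^ 2)) * (deriv (deriv (deriv (theta τ))) 0 *
        deriv (theta τ) 0 / ModularForm.eta τ ^ 6) := by
      rw [thetaConst, d3, d1, invEta_eq]
      simp only [mul_zero, Complex.exp_zero]
      ring
    have hη' := eta_ne_zero τ
    rw [e]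
    field_simp
    linear_combination (3 * deriv (deriv (deriv (theta τ))) 0) * h1
  rw [phiZero_eq, wpTheta_eq, add_div, hL, hC, phiNeg2]
  ring

lemma isWeak_phiNeg2 : IsWeak phiNeg2 := by
  have := (isWeak_zeta.mul (isWeak_thetaSeries.mul isWeak_thetaSeries)).mul isWeak_invEta
  simpa only [← sq, ← phiNeg2_eq] using this

lemma isWeak_phiZero : IsWeak phiZero := by
  have hw := isWeak_thetaSeries
  have h1 := (isWeak_zeta.mul ((hw.deriv.mul hw.deriv).sub (hw.mul hw.deriv.deriv))).mul
    isWeak_invEta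
  have := (h1.add (isWeak_thetaConst.mul isWeak_phiNeg2)).const_mul (-(3 / (π : ℂ) ^ 2))
  simpa only [← sq, ← phiZero_eq_expansion] using this

/-- The limits of `φ_{-2,1}` and `φ_{0,1}` at `i∞` are `u` and `12 + κ u`, where
`u = ζ - 2 + ζ⁻¹`. -/
lemma exists_tendsto_phi : ∃ κ : ℂ, ∀ z,
    Tendsto (phiNeg2 · z) UpperHalfPlane.atImInfty
      (𝓝 (cexp (2 * π * I * z) * (1 - cexp (-(2 * π * I * z))) ^ 2)) ∧
    Tendsto (phiZero · z) UpperHalfPlane.atImInfty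
      (𝓝 (12 + κ * (cexp (2 * π * I * z) * (1 - cexp (-(2 * π * I * z))) ^ 2))) := by
  obtain ⟨a, ha⟩ := isWeak_thetaConst
  have hκ := tendsto_of_hasSum (F := fun τ _ ↦ thetaConst τ) ha 0
  set κ := ∑' l : ℤ, a (0, l) * cexp (2 * π * I * (l * 0))
  refine ⟨-(3 / (π : ℂ) ^ 2) * κ, fun z ↦ ?_⟩
  have t0 := tendsto_iterate_deriv_thetaSeries 0 z
  have t1 := tendsto_iterate_deriv_thetaSeries 1 z
  have t2 := tendsto_iterate_deriv_thetaSeries 2 z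
  simp only [Function.iterate_succ', Function.iterate_zero, Function.comp_apply, id] at t0 t1 t2
  have hx : Tendsto (phiNeg2 · z) UpperHalfPlane.atImInfty
      (𝓝 (cexp (2 * π * I * z) * (1 - cexp (-(2 * π * I * z))) ^ 2)) := by
    have := ((t0.pow 2).const_mul (cexp (2 * π * I * z))).mul tendsto_invEta
    simpa [← phiNeg2_eq] using this
  refine ⟨hx, ?_⟩
  have := (((((t1.pow 2).sub (t0.mul t2)).const_mul (cexp (2 * π * I * z))).mul
    tendsto_invEta).add (hκ.mul hx)).const_mul (-(3 / (π : ℂ) ^ 2))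
  simp only [← phiZero_eq_expansion] at this
  convert this using 2
  have hπ : (π : ℂ) ≠ 0 := by exact_mod_cast Real.pi_ne_zero
  have he : cexp (2 * π * I * z) * cexp (-(2 * π * I * z)) = 1 := by
    rw [← Complex.exp_add, add_neg_cancel, Complex.exp_zero]
  have hI : (I : ℂ) ^ 2 = -1 := Complex.I_sq
  have h12 : (12 : ℂ) = -(3 / (π : ℂ) ^ 2) * (2 * π * I) ^ 2 := by
    field_simp
    rw [hI]
    norm_num
  rw [h12]
  linear_combination ((3 / (π : ℂ) ^ 2) * (2 * π * I) ^ 2) * he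

/-! ### Jacobi forms for `2A₁` from pairs of Jacobi forms for `A₁` -/

lemma twoA1_form {R : Type*} [CommRing R] (x y : Fin 2 → R) :
    twoA1.form x y = 2 * x 0 * y 0 + 2 * x 1 * y 1 := by
  simp [EvenLattice.form, gramForm, twoA1, Fin.sum_univ_two, Matrix.diagonal_apply]

lemma evenTheta_translate {τ : ℍ} {m : ℕ} {g : ℂ → ℂ} (hg : g ∈ evenTheta τ m) (l μ : ℤ) (z : ℂ) :
    g (z + l * τ + μ) =
      cexp (-(4 * π * I * m * l * z) - 2 * π * I * m * l ^ 2 * τ) * g z := by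
  obtain ⟨-, -, h3, h4⟩ := hg
  have h5 (z : ℂ) : g (z + μ) = g z := by
    have hp : Function.Periodic g 1 := h3
    simpa using hp.int_mul μ z
  rw [h5]
  induction l using Int.induction_on with
  | zero => simp
  | succ l ih =>
    have := h4 (z + (l : ℤ) * τ)
    rw [ih, ← mul_assoc, ← Complex.exp_add] at this
    rw [show z + ((l + 1 : ℤ) : ℂ) * τ = z + (l : ℤ) * τ + τ by push_cast; ring, this]
    congr 2
    push_cast
    ring
  | pred l ih =>
    have := h4 (z + ((-l - 1 : ℤ) : ℂ) * τ)
    rw [show z + ((-l - 1 : ℤ) : ℂ) * τ + τ = z + (-l : ℤ) * τ by push_cast; ring, ih] at this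
    refine mul_left_cancel₀ (Complex.exp_ne_zero
      (-(4 * π * I * m * (z + ((-l - 1 : ℤ) : ℂ) * τ)) - 2 * π * I * m * τ)) ?_
    rw [← this, ← mul_assoc, ← Complex.exp_add]
    congr 2
    push_cast
    ring

/-- The exponent `l / 2` in the `i`-th coordinate, an element of `(2A₁)^∨`. -/
def dualCoord (i : Fin 2) (l : ℤ) : twoA1.dual :=
  ⟨Pi.single i ((l : ℚ) / 2), fun x ↦ ⟨x i * l, by
    rw [twoA1_form]
    fin_cases i <;> simp <;> ring⟩⟩

lemma dualCoord_injective (i : Fin 2) : Function.Injective (dualCoord i) := fun a b h ↦ by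
  have := congrFun (congrArg Subtype.val h) i
  simpa [dualCoord] using this

/-- A weak expansion in the `i`-th elliptic variable is an expansion over the dual lattice. -/
lemma IsWeak.hasExpansion_coord {F : ℍ → ℂ → ℂ} (hF : IsWeak F) (i : Fin 2) :
    HasExpansion (fun p (x : ℍ × (Fin 2 → ℂ)) ↦ fourierMonomial twoA1 p x.1 x.2)
      fun x ↦ F x.1 (x.2 i) := by
  refine HasExpansion.reindex hF (fun p ↦ (p.1, dualCoord i p.2)) (fun p p' h ↦ ?_)
    (fun x : ℍ × (Fin 2 → ℂ) ↦ (x.1, x.2 i)) fun p x ↦ ?_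
  · obtain ⟨h1, h2⟩ := Prod.mk.inj h
    exact Prod.ext h1 (dualCoord_injective i h2)
  · have : twoA1.form x.2 (fun k ↦ (((dualCoord i p.2 : twoA1.dual) : Fin 2 → ℚ) k : ℂ)) =
        p.2 * x.2 i := by
      rw [twoA1_form]
      fin_cases i <;> simp [dualCoord] <;> ring
    rw [fourierMonomial, this, qz, ← Complex.exp_add]
    ring_nf

lemma isWeakJacobiForm_mul {k k' : ℤ} {F G : ℍ → ℂ → ℂ} (hF : IsWeak F) (hG : IsWeak G)
    (hFm : IsModular k F) (hGm : IsModular k' G) (hFe : ∀ τ, F τ ∈ evenTheta τ 1)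
    (hGe : ∀ τ, G τ ∈ evenTheta τ 1) :
    IsWeakJacobiForm twoA1 (k + k') 1 fun τ z ↦ F τ (z 0) * G τ (z 1) where
  holomorphic := by
    have key {F : ℍ → ℂ → ℂ} (hF : IsWeak F) (i : Fin 2) : DifferentiableOn ℂ
        (fun p : ℂ × (Fin 2 → ℂ) ↦ F (ofComplex p.1) (p.2 i)) {p | 0 < p.1.im} := by
      intro p hp
      have h1 : DifferentiableAt ℂ (fun p : ℂ × (Fin 2 → ℂ) ↦ (p.1, p.2 i)) p := by fun_prop
      exact (DifferentiableAt.comp p (hF.differentiableAt ⟨p.1, hp⟩ (p.2 i)) h1).differentiableWithinAt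
    exact (key hF 0).mul (key hG 1)
  modular γ τ z := by
    have h1 := hFm γ τ (z 0)
    have h2 := hGm γ τ (z 1)
    change F (γ • τ) (z 0 / autJ γ τ) * G (γ • τ) (z 1 / autJ γ τ) = autJ γ τ ^ (k + k') *
      cexp (π * I * ((1 : ℤ) : ℂ) * ((γ 1 0 : ℂ) * twoA1.form z z / autJ γ τ)) *
        (F τ (z 0) * G τ (z 1))
    have e : cexp (π * I * ((1 : ℤ) : ℂ) *
        ((γ 1 0 : ℂ) * (2 * z 0 * z 0 + 2 * z 1 * z 1) / autJ γ τ)) =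
        cexp (2 * π * I * ((γ 1 0 : ℂ) * z 0 ^ 2 / autJ γ τ)) *
          cexp (2 * π * I * ((γ 1 0 : ℂ) * z 1 ^ 2 / autJ γ τ)) := by
      rw [← Complex.exp_add]
      push_cast
      ring_nf
    rw [h1, h2, twoA1_form, e, zpow_add₀ (autJ_ne_zero γ τ)]
    ring
  elliptic l μ τ z := by
    rw [evenTheta_translate (hFe τ), evenTheta_translate (hGe τ), twoA1_form, twoA1_form,
      mul_mul_mul_comm, ← Complex.exp_add]
    congr 2
    push_cast
    ring
  fourier := by
    obtain ⟨a, ha⟩ := (hF.hasExpansion_coord 0).mul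
      (fun p p' x ↦ fourierMonomial_add p p' x.1 x.2) (hG.hasExpansion_coord 1)
    exact ⟨a, fun τ z ↦ ha (τ, z)⟩

lemma complexify_apply (g : (Fin 2 → ℤ) ≃ₗ[ℤ] (Fin 2 → ℤ)) (z : Fin 2 → ℂ) (i : Fin 2) :
    complexify g z i = (g (Pi.single 0 1) i : ℂ) * z 0 + (g (Pi.single 1 1) i : ℂ) * z 1 := by
  simp [complexify, Fin.sum_univ_two]

/-- `O(2A₁)` consists of the signed permutations of the coordinates. -/
lemma isOInvariant_of_symm {φ : ℍ → (Fin 2 → ℂ) → ℂ}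
    (hneg : ∀ τ a b, φ τ ![-a, b] = φ τ ![a, b]) (hswap : ∀ τ a b, φ τ ![b, a] = φ τ ![a, b]) :
    IsOInvariant twoA1 φ := by
  intro g hg τ z
  have hneg' (a b) : φ τ ![a, -b] = φ τ ![a, b] := by rw [hswap, hneg, hswap]
  set u := g (Pi.single 0 1) with hu
  set v := g (Pi.single 1 1) with hv
  have h1 : twoA1.form u u = twoA1.form (Pi.single 0 1) (Pi.single 0 1) := hg _ _
  have h2 : twoA1.form v v = twoA1.form (Pi.single 1 1) (Pi.single 1 1) := hg _ _
  have h3 : twoA1.form u v = twoA1.form (Pi.single 0 1) (Pi.single 1 1) := hg _ _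
  rw [twoA1_form, twoA1_form] at h1 h2 h3
  simp at h1 h2 h3
  have hz : z = ![z 0, z 1] := by ext i; fin_cases i <;> rfl
  have hc : complexify g z = ![u 0 * z 0 + v 0 * z 1, u 1 * z 0 + v 1 * z 1] := by
    ext i
    rw [complexify_apply]
    fin_cases i <;> rfl
  have key (a b : ℤ) (h : 2 * a * a + 2 * b * b = 2) :
      (a = 0 ∧ (b = 1 ∨ b = -1)) ∨ ((a = 1 ∨ a = -1) ∧ b = 0) := by
    have ha2 : a * a ≤ 1 := by nlinarith [mul_self_nonneg b]
    have hb2 : b * b ≤ 1 := by nlinarith [mul_self_nonneg a]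
    have ha : a ≤ 1 := by nlinarith
    have ha' : -1 ≤ a := by nlinarith
    have hb : b ≤ 1 := by nlinarith
    have hb' : -1 ≤ b := by nlinarith
    interval_cases a <;> interval_cases b <;> simp at h ⊢
  conv_rhs => rw [hz]
  rw [hc]
  rcases key _ _ h1 with ⟨e1, e2⟩ | ⟨e1, e2⟩ <;> rcases key _ _ h2 with ⟨e3, e4⟩ | ⟨e3, e4⟩
  · rcases e2 with e2 | e2 <;> rcases e4 with e4 | e4 <;> simp [e1, e2, e3, e4] at h3
  · rcases e2 with e2 | e2 <;> rcases e3 with e3 | e3 <;>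
      simp [e1, e2, e3, e4, hneg, hneg'] <;> exact hswap _ _ _
  · rcases e1 with e1 | e1 <;> rcases e4 with e4 | e4 <;> simp [e1, e2, e3, e4, hneg, hneg']
  · rcases e1 with e1 | e1 <;> rcases e3 with e3 | e3 <;> simp [e1, e2, e3, e4] at h3

/-- The reflection in the first coordinate. -/
def reflectFirst : (Fin 2 → ℤ) ≃ₗ[ℤ] (Fin 2 → ℤ) :=
  LinearEquiv.piCongrRight fun i ↦ if i = 0 then LinearEquiv.neg ℤ else LinearEquiv.refl ℤ ℤ

/-- The exchange of the two coordinates. -/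
def swapCoords : (Fin 2 → ℤ) ≃ₗ[ℤ] (Fin 2 → ℤ) := LinearEquiv.funCongrLeft ℤ ℤ (Equiv.swap 0 1)

lemma IsOInvariant.neg_left {φ : ℍ → (Fin 2 → ℂ) → ℂ} (h : IsOInvariant twoA1 φ) (τ : ℍ) (a b : ℂ) :
    φ τ ![-a, b] = φ τ ![a, b] := by
  have hg : reflectFirst ∈ twoA1.orthogonalGroup := fun x y ↦ by
    simp [twoA1_form, reflectFirst]
  rw [← h _ hg τ ![a, b]]
  congr 1
  ext i
  rw [complexify_apply]
  fin_cases i <;> simp [reflectFirst]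

lemma IsOInvariant.swap {φ : ℍ → (Fin 2 → ℂ) → ℂ} (h : IsOInvariant twoA1 φ) (τ : ℍ) (a b : ℂ) :
    φ τ ![b, a] = φ τ ![a, b] := by
  have hg : swapCoords ∈ twoA1.orthogonalGroup := fun x y ↦ by
    simp [twoA1_form, swapCoords, LinearEquiv.funCongrLeft_apply, LinearMap.funLeft_apply]
    ring
  rw [← h _ hg τ ![a, b]]
  congr 1
  ext i
  rw [complexify_apply]
  fin_cases i <;>
    simp [swapCoords, LinearEquiv.funCongrLeft_apply, LinearMap.funLeft_apply]

lemma phiNeg2_neg (τ : ℍ) (z : ℂ) : phiNeg2 τ (-z) = phiNeg2 τ z := (phiNeg2_mem_evenTheta τ).2.1 z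

lemma phiZero_neg (τ : ℍ) (z : ℂ) : phiZero τ (-z) = phiZero τ z := (phiZero_mem_evenTheta τ).2.1 z

lemma genZero_mem : genZero ∈ jacobiForms twoA1 (0, 1) := by
  refine ⟨?_, isOInvariant_of_symm (fun τ a b ↦ ?_) fun τ a b ↦ ?_⟩
  · exact isWeakJacobiForm_mul isWeak_phiZero isWeak_phiZero isModular_phiZero isModular_phiZero
      phiZero_mem_evenTheta phiZero_mem_evenTheta
  · simp [genZero, phiZero_neg]
  · simp [genZero, mul_comm]

lemma genNeg2_mem : genNeg2 ∈ jacobiForms twoA1 (-2, 1) := by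
  refine ⟨?_, isOInvariant_of_symm (fun τ a b ↦ ?_) fun τ a b ↦ ?_⟩
  · have h1 := isWeakJacobiForm_mul isWeak_phiNeg2 isWeak_phiZero isModular_phiNeg2
      isModular_phiZero phiNeg2_mem_evenTheta phiZero_mem_evenTheta
    have h2 := isWeakJacobiForm_mul isWeak_phiZero isWeak_phiNeg2 isModular_phiZero
      isModular_phiNeg2 phiZero_mem_evenTheta phiNeg2_mem_evenTheta
    exact h1.add h2
  · simp [genNeg2, phiZero_neg, phiNeg2_neg]
  · simp only [genNeg2, Matrix.cons_val_zero, Matrix.cons_val_one]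
    ring

lemma genNeg4_mem : genNeg4 ∈ jacobiForms twoA1 (-4, 1) := by
  refine ⟨?_, isOInvariant_of_symm (fun τ a b ↦ ?_) fun τ a b ↦ ?_⟩
  · exact isWeakJacobiForm_mul isWeak_phiNeg2 isWeak_phiNeg2 isModular_phiNeg2 isModular_phiNeg2
      phiNeg2_mem_evenTheta phiNeg2_mem_evenTheta
  · simp [genNeg4, phiNeg2_neg]
  · simp [genNeg4, mul_comm]

/-! ### The monomials in `φ_{-2,1}` and `φ_{0,1}` as a basis of the even theta functions -/

/-- At a fixed `τ`, the quotient `φ_{-2,1} / φ_{0,1}` takes infinitely many values: it is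
continuous at `0`, where it has an isolated zero. -/
lemma infinite_ratio (τ : ℍ) :
    ((fun z ↦ phiNeg2 τ z / phiZero τ z) '' {z | phiZero τ z ≠ 0}).Infinite := by
  set s : ℂ → ℂ := fun z ↦ phiNeg2 τ z / phiZero τ z with hs
  intro hfin
  have hy : phiZero τ 0 ≠ 0 := by rw [phiZero_zero]; norm_num
  have hyc := (phiZero_mem_evenTheta τ).1.continuous
  have hsc : ContinuousAt s 0 :=
    (phiNeg2_mem_evenTheta τ).1.continuous.continuousAt.div hyc.continuousAt hy
  have hs0 : s 0 = 0 := by simp [hs, phiNeg2_zero]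
  have h1 : ∀ᶠ z in 𝓝 0, s z ∉ (s '' {z | phiZero τ z ≠ 0}) \ {0} :=
    hsc.preimage_mem_nhds (IsOpen.mem_nhds hfin.sdiff.isClosed.isOpen_compl (by simp [hs0]))
  obtain ⟨z, ⟨h2, h3⟩, h4⟩ := ((eventually_nhdsWithin_of_eventually_nhds
    (h1.and (hyc.continuousAt.eventually_ne hy))).and (eventually_phiNeg2_ne_zero τ)).exists
  exact h2 ⟨⟨z, h3, rfl⟩, div_ne_zero h4 h3⟩

/-- The monomial `φ_{-2,1} ^ i * φ_{0,1} ^ (m - i)`. -/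
def phiMonomial (m : ℕ) (i : Fin (m + 1)) (τ : ℍ) (z : ℂ) : ℂ :=
  phiNeg2 τ z ^ i.1 * phiZero τ z ^ i.rev.1

/-- The values of the monomials of degree `m` at `m + 1` points. -/
def phiMatrix {m : ℕ} (τ : ℍ) (a : Fin (m + 1) → ℂ) : Matrix (Fin (m + 1)) (Fin (m + 1)) ℂ :=
  Matrix.projVandermonde (fun p ↦ phiNeg2 τ (a p)) (fun p ↦ phiZero τ (a p))

lemma phiMatrix_apply {m : ℕ} (τ : ℍ) (a : Fin (m + 1) → ℂ) (p i : Fin (m + 1)) :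
    phiMatrix τ a p i = phiMonomial m i τ (a p) := rfl

lemma phiMonomial_mem_evenTheta {m : ℕ} (i : Fin (m + 1)) (τ : ℍ) :
    phiMonomial m i τ ∈ evenTheta τ m := by
  have h := mul_mem_evenTheta (pow_mem_evenTheta (phiNeg2_mem_evenTheta τ) i.1)
    (pow_mem_evenTheta (phiZero_mem_evenTheta τ) i.rev.1)
  have hi : i.1 + i.rev.1 = m := by rw [Fin.val_rev]; omega
  rwa [hi] at h

lemma exists_phiMatrix_det_ne_zero (τ : ℍ) (m : ℕ) :
    ∃ a : Fin (m + 1) → ℂ, (phiMatrix τ a).det ≠ 0 := by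
  let f := (infinite_ratio τ).natEmbedding
  choose a ha0 ha using fun n ↦ (f n).2
  refine ⟨fun p ↦ a p, ?_⟩
  rw [phiMatrix, Matrix.det_projVandermonde]
  refine Finset.prod_ne_zero_iff.mpr fun i _ ↦ Finset.prod_ne_zero_iff.mpr fun j hj ↦ ?_
  intro h
  have h1 : phiNeg2 τ (a i) / phiZero τ (a i) = phiNeg2 τ (a j) / phiZero τ (a j) := by
    rw [div_eq_div_iff (ha0 _) (ha0 _)]
    linear_combination -h
  have h2 : f i = f j := Subtype.ext ((ha i).symm.trans (h1.trans (ha j)))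
  exact (Finset.mem_Ioi.mp hj).ne (Fin.ext (f.injective h2))

lemma linearIndependent_phiMonomial (m : ℕ) (τ : ℍ) :
    LinearIndependent ℂ fun i ↦ phiMonomial m i τ := by
  obtain ⟨a, ha⟩ := exists_phiMatrix_det_ne_zero τ m
  refine Fintype.linearIndependent_iff.mpr fun c hc ↦ congrFun (Matrix.eq_zero_of_mulVec_eq_zero ha ?_)
  funext p
  have := congrFun hc (a p)
  simpa [Matrix.mulVec, dotProduct, phiMatrix_apply, mul_comm] using this

/-- Interpolation of an even theta function at points where the matrix of values of the monomials
is invertible. -/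
lemma evenTheta_interpolation {m : ℕ} {τ : ℍ} {a : Fin (m + 1) → ℂ} (ha : (phiMatrix τ a).det ≠ 0)
    {g : ℂ → ℂ} (hg : g ∈ evenTheta τ m) (z : ℂ) :
    g z = ∑ i, ∑ p, (phiMatrix τ a)⁻¹ i p * g (a p) * phiMonomial m i τ z := by
  obtain ⟨c, rfl⟩ := (Submodule.mem_span_range_iff_exists_fun ℂ).mp (mem_span_of_linearIndependent
    (fun i ↦ phiMonomial_mem_evenTheta i τ) (linearIndependent_phiMonomial m τ) hg)
  have h1 : (fun p ↦ (∑ i, c i • phiMonomial m i τ) (a p)) = (phiMatrix τ a).mulVec c := by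
    funext p
    simp [Matrix.mulVec, dotProduct, phiMatrix_apply, mul_comm]
  have h2 : (phiMatrix τ a)⁻¹.mulVec ((phiMatrix τ a).mulVec c) = c := by
    rw [Matrix.mulVec_mulVec, Matrix.nonsing_inv_mul _ (isUnit_iff_ne_zero.mpr ha),
      Matrix.one_mulVec]
  rw [← h1] at h2
  rw [Finset.sum_apply]
  refine Finset.sum_congr rfl fun i _ ↦ ?_
  rw [← Finset.sum_mul]
  conv_lhs => rw [← h2]
  rfl

/-- The function on `ℂ²` with coefficients `C` in the products of the monomials. -/
def phiForm {m : ℕ} (τ : ℍ) (C : Matrix (Fin (m + 1)) (Fin (m + 1)) ℂ) (z w : ℂ) : ℂ :=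
  ∑ i, ∑ j, C i j * (phiMonomial m i τ z * phiMonomial m j τ w)

lemma phiForm_apply {m : ℕ} (τ : ℍ) (C : Matrix (Fin (m + 1)) (Fin (m + 1)) ℂ)
    (a : Fin (m + 1) → ℂ) (p q : Fin (m + 1)) :
    phiForm τ C (a p) (a q) = (phiMatrix τ a * C * (phiMatrix τ a).transpose) p q := by
  simp only [phiForm, Matrix.mul_apply, Matrix.transpose_apply, phiMatrix_apply, Finset.sum_mul]
  rw [Finset.sum_comm]
  exact Finset.sum_congr rfl fun i _ ↦ Finset.sum_congr rfl fun j _ ↦ by ring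

/-- The coefficients of a function in the products of the monomials are determined by its values
at pairs of interpolation points. -/
lemma eq_inv_mul_mul_inv {m : ℕ} {τ : ℍ} {a : Fin (m + 1) → ℂ} (ha : (phiMatrix τ a).det ≠ 0)
    (C : Matrix (Fin (m + 1)) (Fin (m + 1)) ℂ) :
    C = (phiMatrix τ a)⁻¹ * Matrix.of (fun p q ↦ phiForm τ C (a p) (a q)) *
      ((phiMatrix τ a)⁻¹).transpose := by
  have h : Matrix.of (fun p q ↦ phiForm τ C (a p) (a q)) =
      phiMatrix τ a * C * (phiMatrix τ a).transpose := by
    ext p q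
    exact phiForm_apply τ C a p q
  have h1 := Matrix.nonsing_inv_mul _ (isUnit_iff_ne_zero.mpr ha)
  have h2 : (phiMatrix τ a).transpose * ((phiMatrix τ a)⁻¹).transpose = 1 := by
    rw [← Matrix.transpose_mul, h1, Matrix.transpose_one]
  rw [h, Matrix.mul_assoc, Matrix.mul_assoc, h2, Matrix.mul_one, ← Matrix.mul_assoc, h1,
    Matrix.one_mul]

lemma phiForm_injective {m : ℕ} (τ : ℍ) : Function.Injective (phiForm (m := m) τ) := by
  obtain ⟨a, ha⟩ := exists_phiMatrix_det_ne_zero τ m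
  intro C D h
  rw [eq_inv_mul_mul_inv ha C, eq_inv_mul_mul_inv ha D, h]

/-- A function of two variables that is an even theta function in each of them. -/
lemma exists_eq_phiForm {m : ℕ} {τ : ℍ} {g : ℂ → ℂ → ℂ} (h1 : ∀ w, (g · w) ∈ evenTheta τ m)
    (h2 : ∀ z, g z ∈ evenTheta τ m) : ∃ C, g = phiForm (m := m) τ C := by
  obtain ⟨a, ha⟩ := exists_phiMatrix_det_ne_zero τ m
  refine ⟨fun i j ↦ ∑ p, ∑ q, (phiMatrix τ a)⁻¹ i p * ((phiMatrix τ a)⁻¹ j q * g (a p) (a q)), ?_⟩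
  funext z w
  simp only [phiForm]
  rw [evenTheta_interpolation ha (h1 w) z]
  refine Finset.sum_congr rfl fun i _ ↦ ?_
  calc _ = ∑ p, ∑ j, ∑ q, (phiMatrix τ a)⁻¹ i p * ((phiMatrix τ a)⁻¹ j q * g (a p) (a q)) *
        (phiMonomial m i τ z * phiMonomial m j τ w) := by
        refine Finset.sum_congr rfl fun p _ ↦ ?_
        rw [evenTheta_interpolation ha (h2 (a p)) w]
        simp only [Finset.mul_sum, Finset.sum_mul]
        exact Finset.sum_congr rfl fun j _ ↦ Finset.sum_congr rfl fun q _ ↦ by ring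
    _ = _ := by
        rw [Finset.sum_comm]
        simp only [Finset.sum_mul]

/-! ### The coefficients of an invariant weak Jacobi form -/

section Coefficients

variable {k : ℤ} {m : ℕ} {φ : ℍ → (Fin 2 → ℂ) → ℂ}

lemma fst_mem_evenTheta (h : φ ∈ jacobiForms twoA1 (k, m)) (τ : ℍ) (w : ℂ) :
    (fun z ↦ φ τ ![z, w]) ∈ evenTheta τ m := by
  obtain ⟨⟨hd, -, he, -⟩, hO⟩ := h
  refine ⟨fun z ↦ ?_, fun z ↦ hO.neg_left τ z w, fun z ↦ ?_, fun z ↦ ?_⟩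
  · have hopen : IsOpen {p : ℂ × (Fin 2 → ℂ) | 0 < p.1.im} :=
      isOpen_lt continuous_const (by fun_prop)
    have h1 := hd.differentiableAt (x := ((τ : ℂ), ![z, w])) (hopen.mem_nhds τ.im_pos)
    have h2 : DifferentiableAt ℂ (fun z : ℂ ↦ ((τ : ℂ), ![z, w])) z := by
      refine (differentiableAt_const _).prodMk (differentiableAt_pi.mpr fun i ↦ ?_)
      fin_cases i <;> simp
    simpa [Function.comp_def] using h1.comp z h2
  · have := he 0 ![1, 0] τ ![z, w]
    simp [twoA1_form] at this
    convert this using 2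
    ext i
    fin_cases i <;> simp
  · have := he ![1, 0] 0 τ ![z, w]
    rw [twoA1_form, twoA1_form] at this
    simp at this
    convert this using 2
    · ext i
      fin_cases i <;> simp
    · ring_nf

lemma snd_mem_evenTheta (h : φ ∈ jacobiForms twoA1 (k, m)) (τ : ℍ) (z : ℂ) :
    (fun w ↦ φ τ ![z, w]) ∈ evenTheta τ m := by
  convert fst_mem_evenTheta h τ z using 2 with w
  exact h.2.swap τ _ _

lemma exists_coefficients (h : φ ∈ jacobiForms twoA1 (k, m)) :
    ∃ C : ℍ → Matrix (Fin (m + 1)) (Fin (m + 1)) ℂ, ∀ τ z w, φ τ ![z, w] = phiForm τ (C τ) z w := by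
  choose C hC using fun τ ↦ exists_eq_phiForm (fst_mem_evenTheta h τ) (snd_mem_evenTheta h τ)
  exact ⟨C, fun τ z w ↦ congrFun (congrFun (hC τ) z) w⟩

variable {C : ℍ → Matrix (Fin (m + 1)) (Fin (m + 1)) ℂ}

lemma coefficients_symm (h : φ ∈ jacobiForms twoA1 (k, m))
    (hC : ∀ τ z w, φ τ ![z, w] = phiForm τ (C τ) z w) (τ : ℍ) (i j : Fin (m + 1)) :
    C τ i j = C τ j i := by
  have : C τ = (C τ).transpose := by
    refine phiForm_injective τ ?_
    funext z w
    rw [← hC, ← h.2.swap, hC, phiForm, phiForm, Finset.sum_comm]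
    exact Finset.sum_congr rfl fun i _ ↦ Finset.sum_congr rfl fun j _ ↦ by
      rw [Matrix.transpose_apply]; ring
  exact congrFun (congrFun this i) j

lemma phiMonomial_smul (i : Fin (m + 1)) (γ : SL(2, ℤ)) (τ : ℍ) (z : ℂ) :
    phiMonomial m i (γ • τ) (z / autJ γ τ) = autJ γ τ ^ (-2 * (i : ℤ)) *
      cexp (2 * π * I * m * ((γ 1 0 : ℂ) * z ^ 2 / autJ γ τ)) * phiMonomial m i τ z := by
  have hi : (m : ℂ) = i.1 + i.rev.1 := by
    rw [← Nat.cast_add]; congr 1; rw [Fin.val_rev]; omega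
  rw [phiMonomial, isModular_phiNeg2, isModular_phiZero, phiMonomial, hi, zpow_zero, one_mul,
    mul_pow, mul_pow, mul_pow, ← Complex.exp_nat_mul, ← Complex.exp_nat_mul, zpow_mul, zpow_natCast]
  rw [show (2 * π * I * (i.1 + i.rev.1) * ((γ 1 0 : ℂ) * z ^ 2 / autJ γ τ) : ℂ) =
    i.1 * (2 * π * I * ((γ 1 0 : ℂ) * z ^ 2 / autJ γ τ)) +
      i.rev.1 * (2 * π * I * ((γ 1 0 : ℂ) * z ^ 2 / autJ γ τ)) by ring, Complex.exp_add]
  ring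

lemma coefficients_smul (h : φ ∈ jacobiForms twoA1 (k, m))
    (hC : ∀ τ z w, φ τ ![z, w] = phiForm τ (C τ) z w) (γ : SL(2, ℤ)) (τ : ℍ) (i j : Fin (m + 1)) :
    C (γ • τ) i j = autJ γ τ ^ (k + 2 * i + 2 * j) * C τ i j := by
  have hJ := autJ_ne_zero γ τ
  have key : (fun i j ↦ autJ γ τ ^ (-2 * (i : ℤ)) * autJ γ τ ^ (-2 * (j : ℤ)) * C (γ • τ) i j :
      Matrix (Fin (m + 1)) (Fin (m + 1)) ℂ) = autJ γ τ ^ k • C τ := by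
    refine phiForm_injective τ ?_
    funext z w
    have h1 : φ (γ • τ) (fun i ↦ ![z, w] i / autJ γ τ) = autJ γ τ ^ k *
        cexp (π * I * ((m : ℤ) : ℂ) * ((γ 1 0 : ℂ) * twoA1.form ![z, w] ![z, w] / autJ γ τ)) *
          φ τ ![z, w] := h.1.modular γ τ ![z, w]
    have e1 : (fun i ↦ ![z, w] i / autJ γ τ) = ![z / autJ γ τ, w / autJ γ τ] := by
      ext i; fin_cases i <;> rfl
    have e2 : cexp (π * I * ((m : ℤ) : ℂ) * ((γ 1 0 : ℂ) * twoA1.form ![z, w] ![z, w] /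
        autJ γ τ)) = cexp (2 * π * I * m * ((γ 1 0 : ℂ) * z ^ 2 / autJ γ τ)) *
          cexp (2 * π * I * m * ((γ 1 0 : ℂ) * w ^ 2 / autJ γ τ)) := by
      rw [twoA1_form, ← Complex.exp_add]
      congr 1
      simp
      ring
    rw [e1, e2, hC, hC] at h1
    refine mul_left_cancel₀ (mul_ne_zero
      (Complex.exp_ne_zero (2 * π * I * m * ((γ 1 0 : ℂ) * z ^ 2 / autJ γ τ)))
      (Complex.exp_ne_zero (2 * π * I * m * ((γ 1 0 : ℂ) * w ^ 2 / autJ γ τ)))) ?_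
    simp only [phiForm, phiMonomial_smul, Finset.mul_sum, Matrix.smul_apply, smul_eq_mul] at h1 ⊢
    refine (Finset.sum_congr rfl fun i _ ↦ Finset.sum_congr rfl fun j _ ↦ ?_).trans
      (h1.trans (Finset.sum_congr rfl fun i _ ↦ Finset.sum_congr rfl fun j _ ↦ ?_)) <;> ring
  have := congrFun (congrFun key i) j
  simp only [Matrix.smul_apply, smul_eq_mul] at this
  rw [add_assoc, zpow_add₀ hJ, mul_right_comm, ← this, zpow_add₀ hJ]
  rw [show (-2 * (i : ℤ)) = -(2 * i) by ring, show (-2 * (j : ℤ)) = -(2 * j) by ring, zpow_neg,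
    zpow_neg]
  field_simp

end Coefficients

/-! ### The coefficients are modular forms -/

lemma differentiableAt_det {ι : Type*} [Fintype ι] [DecidableEq ι] {M : ℂ → Matrix ι ι ℂ} {x : ℂ}
    (h : ∀ i j, DifferentiableAt ℂ (fun w ↦ M w i j) x) :
    DifferentiableAt ℂ (fun w ↦ (M w).det) x := by
  simp only [Matrix.det_apply']
  fun_prop

lemma inv_apply_eq {ι : Type*} [Fintype ι] [DecidableEq ι] (M : Matrix ι ι ℂ) (i j : ι) :
    M⁻¹ i j = M.det⁻¹ * (M.updateRow j (Pi.single i 1)).det := by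
  rw [Matrix.inv_def, Ring.inverse_eq_inv', Matrix.smul_apply, smul_eq_mul, Matrix.adjugate_apply]

lemma differentiableAt_inv_apply {ι : Type*} [Fintype ι] [DecidableEq ι] {M : ℂ → Matrix ι ι ℂ}
    {x : ℂ} (h : ∀ i j, DifferentiableAt ℂ (fun w ↦ M w i j) x) (hx : (M x).det ≠ 0) (i j : ι) :
    DifferentiableAt ℂ (fun w ↦ (M w)⁻¹ i j) x := by
  simp only [inv_apply_eq]
  refine ((differentiableAt_det h).inv hx).mul (differentiableAt_det fun p q ↦ ?_)
  rcases eq_or_ne p j with rfl | hp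
  · simp
  · simpa [Matrix.updateRow_ne hp] using h p q

lemma tendsto_inv_apply {ι α : Type*} [Fintype ι] [DecidableEq ι] {M : α → Matrix ι ι ℂ}
    {l : Filter α} {N : Matrix ι ι ℂ} (h : Tendsto M l (𝓝 N)) (hN : N.det ≠ 0) (i j : ι) :
    Tendsto (fun t ↦ (M t)⁻¹ i j) l (𝓝 (N⁻¹ i j)) := by
  have hd : Continuous fun A : Matrix ι ι ℂ ↦ A.det := continuous_id.matrix_det
  have ha : Continuous fun A : Matrix ι ι ℂ ↦ A.adjugate i j :=
    (continuous_id.matrix_adjugate).matrix_elem i j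
  simp only [Matrix.inv_def, Ring.inverse_eq_inv', Matrix.smul_apply, smul_eq_mul]
  exact (((hd.tendsto N).comp h).inv₀ hN).mul ((ha.tendsto N).comp h)

/-- At a point `z` with `ζ = p + 1`, the limit `ζ - 2 + ζ⁻¹` of `φ_{-2,1}` at `i∞` is
`p ^ 2 / (p + 1)`; these values are distinct. -/
lemma exists_phiMatrix_tendsto (m : ℕ) : ∃ (a : Fin (m + 1) → ℂ)
    (N : Matrix (Fin (m + 1)) (Fin (m + 1)) ℂ), N.det ≠ 0 ∧
      Tendsto (fun τ ↦ phiMatrix τ a) UpperHalfPlane.atImInfty (𝓝 N) := by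
  obtain ⟨κ, hκ⟩ := exists_tendsto_phi
  let a : Fin (m + 1) → ℂ := fun p ↦ Complex.log (p.1 + 1) / (2 * π * I)
  let u : Fin (m + 1) → ℂ := fun p ↦
    cexp (2 * π * I * a p) * (1 - cexp (-(2 * π * I * a p))) ^ 2
  have hu (p : Fin (m + 1)) : u p = p.1 ^ 2 / (p.1 + 1) := by
    have h1 : (p.1 + 1 : ℂ) ≠ 0 := Nat.cast_add_one_ne_zero p.1
    have h2 : cexp (2 * π * I * a p) = p.1 + 1 := by
      rw [mul_div_cancel₀ _ two_pi_I_ne_zero, Complex.exp_log h1]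
    simp only [u]
    rw [Complex.exp_neg, h2]
    field_simp
    ring
  refine ⟨a, Matrix.projVandermonde u fun p ↦ 12 + κ * u p, ?_, ?_⟩
  · rw [Matrix.det_projVandermonde]
    refine Finset.prod_ne_zero_iff.mpr fun i _ ↦ Finset.prod_ne_zero_iff.mpr fun j hj ↦ ?_
    intro h
    have h1 : u i = u j := by linear_combination -h / 12
    have hlt : i < j := Finset.mem_Ioi.mp hj
    rw [hu, hu, div_eq_div_iff (Nat.cast_add_one_ne_zero _) (Nat.cast_add_one_ne_zero _)] at h1
    have h2 : i.1 ^ 2 * (j.1 + 1) = j.1 ^ 2 * (i.1 + 1) := by exact_mod_cast h1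
    have h3 : i.1 * i.1 < j.1 * j.1 := Nat.mul_self_lt_mul_self hlt
    have h4 : i.1 * j.1 * i.1 ≤ i.1 * j.1 * j.1 := Nat.mul_le_mul_left _ hlt.le
    nlinarith
  · refine tendsto_pi_nhds.mpr fun p ↦ tendsto_pi_nhds.mpr fun i ↦ ?_
    exact ((hκ (a p)).1.pow i.1).mul ((hκ (a p)).2.pow i.rev.1)

section Coefficients

variable {k : ℤ} {m : ℕ} {φ : ℍ → (Fin 2 → ℂ) → ℂ}

lemma isBoundedAtImInfty_of_isWeakJacobiForm {n : ℕ} {L : EvenLattice n} {k m : ℤ}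
    {φ : ℍ → (Fin n → ℂ) → ℂ} (h : IsWeakJacobiForm L k m φ) (z : Fin n → ℂ) :
    UpperHalfPlane.IsBoundedAtImInfty fun τ ↦ φ τ z := by
  obtain ⟨a, ha⟩ := h.fourier
  have hs := (ha UpperHalfPlane.I z).summable.norm
  refine UpperHalfPlane.isBoundedAtImInfty_iff.mpr
    ⟨∑' p, ‖a p * fourierMonomial L p UpperHalfPlane.I z‖, 1, fun τ hτ ↦ ?_⟩
  rw [← (ha τ z).tsum_eq]
  have hle (p : FourierIndex L) : ‖a p * fourierMonomial L p τ z‖ ≤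
      ‖a p * fourierMonomial L p UpperHalfPlane.I z‖ := by
    simp only [fourierMonomial, norm_mul]
    refine mul_le_mul_of_nonneg_left (mul_le_mul_of_nonneg_right ?_ (norm_nonneg _))
      (norm_nonneg _)
    rw [Complex.norm_exp, Complex.norm_exp, Real.exp_le_exp]
    have : (p.1 : ℝ) ≤ p.1 * τ.im := le_mul_of_one_le_right (Nat.cast_nonneg _) hτ
    have hπ := Real.pi_pos
    simp [mul_assoc]
    nlinarith
  exact (norm_tsum_le_tsum_norm (hs.of_nonneg_of_le (fun _ ↦ norm_nonneg _) hle)).trans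
    ((hs.of_nonneg_of_le (fun _ ↦ norm_nonneg _) hle).tsum_le_tsum hle hs)

variable {C : ℍ → Matrix (Fin (m + 1)) (Fin (m + 1)) ℂ}

lemma coefficients_eq (hC : ∀ τ z w, φ τ ![z, w] = phiForm τ (C τ) z w) {τ : ℍ}
    {a : Fin (m + 1) → ℂ} (ha : (phiMatrix τ a).det ≠ 0) (i j : Fin (m + 1)) :
    C τ i j = ∑ q, (∑ p, (phiMatrix τ a)⁻¹ i p * φ τ ![a p, a q]) * (phiMatrix τ a)⁻¹ j q := by
  have h := congrFun (congrFun (eq_inv_mul_mul_inv ha (C τ)) i) j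
  simpa only [← hC, Matrix.mul_apply, Matrix.of_apply, Matrix.transpose_apply] using h

lemma coefficients_bounded (h : φ ∈ jacobiForms twoA1 (k, m))
    (hC : ∀ τ z w, φ τ ![z, w] = phiForm τ (C τ) z w) (i j : Fin (m + 1)) :
    UpperHalfPlane.IsBoundedAtImInfty fun τ ↦ C τ i j := by
  obtain ⟨a, N, hN, ht⟩ := exists_phiMatrix_tendsto m
  have hd : Continuous fun A : Matrix (Fin (m + 1)) (Fin (m + 1)) ℂ ↦ A.det :=
    continuous_id.matrix_det
  have hne := ((hd.tendsto N).comp ht).eventually_ne hN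
  have hinv (i p) : (fun τ ↦ (phiMatrix τ a)⁻¹ i p) =O[UpperHalfPlane.atImInfty] (1 : ℍ → ℝ) :=
    (tendsto_inv_apply ht hN i p).isBigO_one ℝ
  have hφ (z) : (fun τ ↦ φ τ z) =O[UpperHalfPlane.atImInfty] (1 : ℍ → ℝ) :=
    isBoundedAtImInfty_of_isWeakJacobiForm h.1 z
  have hmul {f g : ℍ → ℂ} (hf : f =O[UpperHalfPlane.atImInfty] (1 : ℍ → ℝ))
      (hg : g =O[UpperHalfPlane.atImInfty] (1 : ℍ → ℝ)) :
      (fun τ ↦ f τ * g τ) =O[UpperHalfPlane.atImInfty] (1 : ℍ → ℝ) := by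
    simpa [Pi.one_def] using hf.mul hg
  have : (fun τ ↦ ∑ q, (∑ p, (phiMatrix τ a)⁻¹ i p * φ τ ![a p, a q]) * (phiMatrix τ a)⁻¹ j q)
      =O[UpperHalfPlane.atImInfty] (1 : ℍ → ℝ) :=
    .fun_sum fun q _ ↦ hmul (.fun_sum fun p _ ↦ hmul (hinv i p) (hφ _)) (hinv j q)
  refine this.congr' ?_ EventuallyEq.rfl
  filter_upwards [hne] with τ hτ
  exact (coefficients_eq hC hτ i j).symm

lemma coefficients_differentiableAt (h : φ ∈ jacobiForms twoA1 (k, m))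
    (hC : ∀ τ z w, φ τ ![z, w] = phiForm τ (C τ) z w) (i j : Fin (m + 1)) (τ : ℍ) :
    DifferentiableAt ℂ (fun w ↦ C (ofComplex w) i j) τ := by
  obtain ⟨a, ha⟩ := exists_phiMatrix_det_ne_zero τ m
  have hM (p i) : DifferentiableAt ℂ (fun w : ℂ ↦ phiMatrix (ofComplex w) a p i) τ :=
    ((isWeak_phiNeg2.differentiableAt_left τ (a p)).pow i.1).mul
      ((isWeak_phiZero.differentiableAt_left τ (a p)).pow i.rev.1)
  have hτ : ofComplex (τ : ℂ) = τ := UpperHalfPlane.ofComplex_apply τ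
  have ha' : (phiMatrix (ofComplex (τ : ℂ)) a).det ≠ 0 := by rwa [hτ]
  have hφ (z) : DifferentiableAt ℂ (fun w : ℂ ↦ φ (ofComplex w) z) τ := by
    have hopen : IsOpen {p : ℂ × (Fin 2 → ℂ) | 0 < p.1.im} :=
      isOpen_lt continuous_const (by fun_prop)
    have h1 := h.1.holomorphic.differentiableAt (x := ((τ : ℂ), z)) (hopen.mem_nhds τ.im_pos)
    have h2 : DifferentiableAt ℂ (fun w : ℂ ↦ (w, z)) τ := by fun_prop
    exact h1.comp (τ : ℂ) h2
  have hinv (i p) : DifferentiableAt ℂ (fun w : ℂ ↦ (phiMatrix (ofComplex w) a)⁻¹ i p) τ :=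
    differentiableAt_inv_apply hM ha' i p
  have hmain : DifferentiableAt ℂ (fun w : ℂ ↦ ∑ q, (∑ p, (phiMatrix (ofComplex w) a)⁻¹ i p *
      φ (ofComplex w) ![a p, a q]) * (phiMatrix (ofComplex w) a)⁻¹ j q) τ :=
    .fun_sum fun q _ ↦ .mul (.fun_sum fun p _ ↦ (hinv i p).mul (hφ _)) (hinv j q)
  refine hmain.congr_of_eventuallyEq ?_
  filter_upwards [(differentiableAt_det hM).continuousAt.eventually_ne ha'] with w hw
  exact coefficients_eq hC hw i j

/-- An invariant weak Jacobi form is a combination, symmetric in the two variables and with modular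
forms as coefficients, of the products of the monomials. -/
theorem exists_modularForm_coefficients (h : φ ∈ jacobiForms twoA1 (k, m)) :
    ∃ f : ∀ i j : Fin (m + 1), ModularForm 𝒮ℒ (k + 2 * i + 2 * j),
      (∀ i j τ, f i j τ = f j i τ) ∧
      ∀ τ z, φ τ z = ∑ i, ∑ j,
        f i j τ * (phiMonomial m i τ (z 0) * phiMonomial m j τ (z 1)) := by
  obtain ⟨C, hC⟩ := exists_coefficients h
  refine ⟨fun i j ↦ mkModularForm _ (fun τ ↦ C τ i j) (coefficients_differentiableAt h hC i j)
    (fun γ τ ↦ coefficients_smul h hC γ τ i j) (coefficients_bounded h hC i j),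
    fun i j τ ↦ coefficients_symm h hC τ i j, fun τ z ↦ ?_⟩
  have hz : z = ![z 0, z 1] := by ext i; fin_cases i <;> rfl
  rw [hz, hC]
  rfl

end Coefficients

/-! ### Generation -/

/-- The subalgebra generated by the three generators. -/
abbrev generatedSubalgebra : Subalgebra ModularFormRing (JacobiRing twoA1) :=
  Algebra.adjoin ModularFormRing (Set.range (generators genZero_mem genNeg2_mem genNeg4_mem))

/-- The function `φ` is an invariant weak Jacobi form of degree `p` which, as an element of the
bigraded ring, is a polynomial in the generators. -/
def IsGenerated (p : ℤ × ℕ) (φ : ℍ → (Fin 2 → ℂ) → ℂ) : Prop :=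
  ∃ h : φ ∈ jacobiForms twoA1 p,
    DirectSum.of (fun p ↦ jacobiForms twoA1 p) p ⟨φ, h⟩ ∈ generatedSubalgebra

namespace IsGenerated

variable {p p' : ℤ × ℕ} {φ ψ : ℍ → (Fin 2 → ℂ) → ℂ}

lemma of_generator (i : Fin 3) (h : φ ∈ jacobiForms twoA1 p)
    (hi : generators genZero_mem genNeg2_mem genNeg4_mem i =
      DirectSum.of (fun p ↦ jacobiForms twoA1 p) p ⟨φ, h⟩) : IsGenerated p φ :=
  ⟨h, Algebra.subset_adjoin ⟨i, hi⟩⟩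

lemma genZero : IsGenerated (0, 1) genZero := of_generator 0 genZero_mem rfl

lemma genNeg2 : IsGenerated (-2, 1) genNeg2 := of_generator 1 genNeg2_mem rfl

lemma genNeg4 : IsGenerated (-4, 1) genNeg4 := of_generator 2 genNeg4_mem rfl

lemma zero : IsGenerated p 0 := ⟨zero_mem _, by
  convert generatedSubalgebra.zero_mem
  exact map_zero (DirectSum.of (fun p ↦ jacobiForms twoA1 p) p)⟩

lemma add (hφ : IsGenerated p φ) (hψ : IsGenerated p ψ) : IsGenerated p (φ + ψ) := by
  obtain ⟨h, hA⟩ := hφ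
  obtain ⟨h', hA'⟩ := hψ
  refine ⟨add_mem h h', ?_⟩
  have := add_mem hA hA'
  rwa [← map_add] at this

lemma sum {ι : Type*} (s : Finset ι) {φ : ι → ℍ → (Fin 2 → ℂ) → ℂ}
    (h : ∀ i ∈ s, IsGenerated p (φ i)) : IsGenerated p (∑ i ∈ s, φ i) :=
  Finset.sum_induction φ (IsGenerated p) (fun _ _ ↦ add) zero h

lemma mul (hφ : IsGenerated p φ) (hψ : IsGenerated p' ψ) : IsGenerated (p + p') (φ * ψ) := by
  obtain ⟨h, hA⟩ := hφ
  obtain ⟨h', hA'⟩ := hψ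
  refine ⟨SetLike.mul_mem_graded h h', ?_⟩
  have := mul_mem hA hA'
  rwa [DirectSum.of_mul_of] at this

lemma modularForm {k : ℤ} (f : ModularForm 𝒮ℒ k) : IsGenerated (k, 0) fun τ _ ↦ f τ := by
  refine ⟨modularForm_mem_jacobiForms twoA1 f, ?_⟩
  have := generatedSubalgebra.algebraMap_mem (DirectSum.of (ModularForm 𝒮ℒ) k f)
  have e : algebraMap ModularFormRing (JacobiRing twoA1) (DirectSum.of (ModularForm 𝒮ℒ) k f) =
    modularFormOf twoA1 k f := modularFormHom_of twoA1 f
  rwa [e] at this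

lemma one : IsGenerated (0, 0) 1 := modularForm (1 : ModularForm 𝒮ℒ 0)

lemma pow (hφ : IsGenerated p φ) (n : ℕ) : IsGenerated (n • p) (φ ^ n) := by
  induction n with
  | zero => rw [zero_smul, pow_zero]; exact one
  | succ n ih => rw [succ_nsmul, pow_succ]; exact ih.mul hφ

lemma neg (hφ : IsGenerated p φ) : IsGenerated p (-φ) := by
  convert (modularForm (-1 : ModularForm 𝒮ℒ 0)).mul hφ using 1
  · simp
  · funext τ z
    simp

/-- The power sums of `φ_{0,1}(z₁) φ_{-2,1}(z₂)` and `φ_{-2,1}(z₁) φ_{0,1}(z₂)`, by Newton's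
recursion: the sum of the two functions is `genNeg2` and their product is `genZero * genNeg4`. -/
lemma powerSum (d : ℕ) : IsGenerated (-2 * d, d) fun τ z ↦
    (phiZero τ (z 0) * phiNeg2 τ (z 1)) ^ d + (phiNeg2 τ (z 0) * phiZero τ (z 1)) ^ d := by
  induction d using Nat.twoStepInduction with
  | zero =>
    convert one.add one using 1
    · simp
    · funext τ z
      simp
  | one =>
    convert genNeg2 using 1
    · simp
    · funext τ z
      simp [WeakJacobi.genNeg2, add_comm]
  | more d h0 h1 =>
    have e1 : ((-2, 1) : ℤ × ℕ) + (-2 * ((d + 1 : ℕ) : ℤ), d + 1) =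
        (-2 * ((d + 2 : ℕ) : ℤ), d + 2) := by
      ext <;> push_cast [Prod.mk_add_mk] <;> ring
    have e2 : ((0, 1) : ℤ × ℕ) + (-4, 1) + (-2 * (d : ℤ), d) =
        (-2 * ((d + 2 : ℕ) : ℤ), d + 2) := by
      ext <;> push_cast [Prod.mk_add_mk] <;> ring
    have g1 := genNeg2.mul h1
    have g2 := ((genZero.mul genNeg4).mul h0).neg
    rw [e1] at g1
    rw [e2] at g2
    convert g1.add g2 using 1
    funext τ z
    simp only [WeakJacobi.genNeg2, WeakJacobi.genZero, WeakJacobi.genNeg4, Pi.add_apply,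
      Pi.mul_apply, Pi.neg_apply]
    ring

/-- The symmetrization of a product of two monomials. -/
lemma symmetrized {m : ℕ} (i j : Fin (m + 1)) :
    IsGenerated (-2 * i - 2 * j, m) fun τ z ↦
      phiMonomial m i τ (z 0) * phiMonomial m j τ (z 1) +
        phiMonomial m j τ (z 0) * phiMonomial m i τ (z 1) := by
  wlog hij : i ≤ j generalizing i j
  · convert this j i (le_of_not_ge hij) using 1
    · ext
      · simp
        ring
      · simp
    · funext τ z
      ring
  obtain ⟨d, hd⟩ := Nat.exists_eq_add_of_le (show i.1 ≤ j.1 from hij)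
  have g := ((genNeg4.pow i.1).mul (genZero.pow j.rev.1)).mul (powerSum d)
  have hr : i.rev.1 = j.rev.1 + d := by rw [Fin.val_rev, Fin.val_rev]; omega
  have hm : i.1 + j.rev.1 + d = m := by rw [Fin.val_rev]; omega
  convert g using 1
  · refine Prod.ext ?_ ?_
    · simp [hd]
      ring
    · simp only [Prod.snd_add, Prod.smul_snd, smul_eq_mul, mul_one, hm]
  · funext τ z
    simp only [WeakJacobi.genZero, WeakJacobi.genNeg4, Pi.mul_apply, Pi.pow_apply, phiMonomial,
      hr, hd]
    ring

end IsGenerated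

lemma isGenerated_of_mem {k : ℤ} {m : ℕ} {φ : ℍ → (Fin 2 → ℂ) → ℂ}
    (h : φ ∈ jacobiForms twoA1 (k, m)) : IsGenerated (k, m) φ := by
  obtain ⟨f, hf, hφ⟩ := exists_modularForm_coefficients h
  have g : IsGenerated (k, m) (∑ i, ∑ j, (fun τ (_ : Fin 2 → ℂ) ↦ ((1 / 2 : ℂ) • f i j) τ) *
      fun τ z ↦ phiMonomial m i τ (z 0) * phiMonomial m j τ (z 1) +
        phiMonomial m j τ (z 0) * phiMonomial m i τ (z 1)) := by
    refine .sum _ fun i _ ↦ .sum _ fun j _ ↦ ?_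
    convert (IsGenerated.modularForm ((1 / 2 : ℂ) • f i j)).mul (.symmetrized i j) using 1
    ext <;> simp
  convert g using 1
  funext τ z
  have hswap : ∑ i, ∑ j, f i j τ * (phiMonomial m j τ (z 0) * phiMonomial m i τ (z 1)) =
      ∑ i, ∑ j, f i j τ * (phiMonomial m i τ (z 0) * phiMonomial m j τ (z 1)) := by
    rw [Finset.sum_comm]
    exact Finset.sum_congr rfl fun i _ ↦ Finset.sum_congr rfl fun j _ ↦ by rw [hf]
  simp only [Finset.sum_apply, Pi.mul_apply, smul_apply, smul_eq_mul, mul_add,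
    Finset.sum_add_distrib, mul_assoc, ← Finset.mul_sum, hswap]
  rw [hφ]
  ring

theorem generatedSubalgebra_eq_top : generatedSubalgebra = ⊤ := by
  refine Algebra.eq_top_iff.mpr fun x ↦ ?_
  induction x using DirectSum.induction_on with
  | zero => exact zero_mem _
  | of p φ => exact (isGenerated_of_mem φ.2).2
  | add x y hx hy => exact add_mem hx hy

/-! ### Algebraic independence -/

lemma eval_smul_of_isHomogeneous {σ R : Type*} [Fintype σ] [CommRing R] {P : MvPolynomial σ R}
    {m : ℕ} (hP : P.IsHomogeneous m) (c : R) (v : σ → R) :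
    MvPolynomial.eval (c • v) P = c ^ m * MvPolynomial.eval v P := by
  rw [MvPolynomial.eval_eq', MvPolynomial.eval_eq', Finset.mul_sum]
  refine Finset.sum_congr rfl fun d hd ↦ ?_
  have hm : ∑ i, d i = m := by
    rw [← Finsupp.degree_eq_sum, Finsupp.degree_eq_weight_one]
    exact hP (MvPolynomial.mem_support_iff.mp hd)
  simp only [Pi.smul_apply, smul_eq_mul, mul_pow, Finset.prod_mul_distrib,
    Finset.prod_pow_eq_pow_sum, hm]
  ring

/-- A homogeneous polynomial in three variables that vanishes at the points `(1, s + t, s t)`, for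
`s` and `t` in an infinite set, is zero. -/
lemma eq_zero_of_isHomogeneous {P : MvPolynomial (Fin 3) ℂ} {m : ℕ} (hP : P.IsHomogeneous m)
    {S : Set ℂ} (hS : S.Infinite)
    (h : ∀ s ∈ S, ∀ t ∈ S, MvPolynomial.eval ![1, s + t, s * t] P = 0) : P = 0 := by
  have heval (x : Fin 2 → ℂ) : MvPolynomial.eval x (MvPolynomial.aeval
      (![1, .X 0 + .X 1, .X 0 * .X 1] : Fin 3 → MvPolynomial (Fin 2) ℂ) P) =
      MvPolynomial.eval ![1, x 0 + x 1, x 0 * x 1] P := by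
    clear h hP
    induction P using MvPolynomial.induction_on with
    | C a => simp
    | add p q hp hq => rw [map_add, map_add, hp, hq, map_add]
    | mul_X p i hp =>
      rw [map_mul, map_mul, hp, map_mul]
      congr 1
      fin_cases i <;> simp
  have hQ : MvPolynomial.aeval (![1, .X 0 + .X 1, .X 0 * .X 1] : Fin 3 → MvPolynomial (Fin 2) ℂ) P
      = 0 := by
    refine MvPolynomial.funext_set (fun _ ↦ S) (fun _ ↦ hS) fun x hx ↦ ?_
    rw [heval, h _ (hx 0 trivial) _ (hx 1 trivial), map_zero]
  have h1 (s t : ℂ) : MvPolynomial.eval ![1, s + t, s * t] P = 0 := by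
    have := heval ![s, t]
    rw [hQ, map_zero] at this
    simpa using this.symm
  refine MvPolynomial.funext_set ![{0}ᶜ, Set.univ, Set.univ] (fun i ↦ ?_) fun x hx ↦ ?_
  · fin_cases i
    · exact (Set.finite_singleton 0).infinite_compl
    · exact Set.infinite_univ
    · exact Set.infinite_univ
  have hx0 : x 0 ≠ 0 := hx 0 trivial
  obtain ⟨d, hd⟩ := IsAlgClosed.exists_pow_nat_eq ((x 1 / x 0) ^ 2 - 4 * (x 2 / x 0)) two_pos
  have := h1 ((x 1 / x 0 + d) / 2) ((x 1 / x 0 - d) / 2)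
  have e : x = x 0 • ![1, (x 1 / x 0 + d) / 2 + (x 1 / x 0 - d) / 2,
      (x 1 / x 0 + d) / 2 * ((x 1 / x 0 - d) / 2)] := by
    funext i
    fin_cases i
    · simp
    · simp
      field_simp
      ring
    · simp
      field_simp
      field_simp at hd
      linear_combination hd
  rw [e, eval_smul_of_isHomogeneous hP, this, mul_zero, map_zero]

/-- The components of the product of an element of `M_*` with a homogeneous element. -/
lemma modularFormHom_mul_of_apply (c : ModularFormRing) {w : ℤ} {m : ℕ}
    (ψ : jacobiForms twoA1 (w, m)) (k : ℤ) (m' : ℕ) (τ : ℍ) (z : Fin 2 → ℂ) :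
    ((modularFormHom twoA1 c * DirectSum.of (fun p ↦ jacobiForms twoA1 p) (w, m) ψ) (k, m') :
      ℍ → (Fin 2 → ℂ) → ℂ) τ z = if m = m' then c (k - w) τ * (ψ : ℍ → (Fin 2 → ℂ) → ℂ) τ z else 0 := by
  induction c using DirectSum.induction_on with
  | zero => simp
  | add x y hx hy =>
    rw [map_add, add_mul, DirectSum.add_apply, DirectSum.add_apply, Submodule.coe_add,
      Pi.add_apply, Pi.add_apply, hx, hy]
    split_ifs
    · rw [add_apply, add_mul]
    · simp
  | of k' f =>
    rw [modularFormHom_of, modularFormOf, AddMonoidHom.comp_apply, DirectSum.of_mul_of]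
    rcases eq_or_ne k (k' + w) with rfl | hk
    · rcases eq_or_ne m m' with rfl | hm
      · have e : k' + w - w = k' := by ring
        have h1 : ((DirectSum.of (ModularForm 𝒮ℒ) k' f) (k' + w - w)) τ = f τ := by
          rw [e, DirectSum.of_eq_same]
        have e2 : ((k' + w, m) : ℤ × ℕ) = (k', 0) + (w, m) := by simp
        rw [if_pos rfl, h1, e2, DirectSum.of_eq_same]
        rfl
      · rw [if_neg hm, DirectSum.of_eq_of_ne]
        · rfl
        · simpa using hm.symm
    · rw [DirectSum.of_eq_of_ne _ _ _ (by simp [hk]), DirectSum.of_eq_of_ne _ _ _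
        (by intro h; exact hk (by linarith))]
      simp

/-- The product of powers of the generators. -/
lemma prod_generators (α : Fin 3 →₀ ℕ) :
    ∃ h : (genZero ^ α 0 * genNeg2 ^ α 1 * genNeg4 ^ α 2) ∈
      jacobiForms twoA1 (-2 * α 1 - 4 * α 2, α 0 + α 1 + α 2),
    ∏ i, generators genZero_mem genNeg2_mem genNeg4_mem i ^ α i =
      DirectSum.of (fun p ↦ jacobiForms twoA1 p) _ ⟨_, h⟩ := by
  have e : α 0 • ((0, 1) : ℤ × ℕ) + α 1 • (-2, 1) + α 2 • (-4, 1) =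
      ((-2 * α 1 - 4 * α 2, α 0 + α 1 + α 2) : ℤ × ℕ) := by
    ext
    · simp
      ring
    · simp
  rw [← e]
  refine ⟨SetLike.mul_mem_graded (SetLike.mul_mem_graded (SetLike.pow_mem_graded _ genZero_mem)
    (SetLike.pow_mem_graded _ genNeg2_mem)) (SetLike.pow_mem_graded _ genNeg4_mem), ?_⟩
  rw [Fin.prod_univ_three]
  change DirectSum.of (fun p ↦ jacobiForms twoA1 p) (0, 1) ⟨genZero, genZero_mem⟩ ^ α 0 *
    DirectSum.of (fun p ↦ jacobiForms twoA1 p) (-2, 1) ⟨genNeg2, genNeg2_mem⟩ ^ α 1 *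
      DirectSum.of (fun p ↦ jacobiForms twoA1 p) (-4, 1) ⟨genNeg4, genNeg4_mem⟩ ^ α 2 = _
  simp only [DirectSum.ofPow, DirectSum.of_mul_of]
  rfl

theorem algebraicIndependent_generators :
    AlgebraicIndependent ModularFormRing (generators genZero_mem genNeg2_mem genNeg4_mem) := by
  refine algebraicIndependent_iff.mpr fun p hp ↦ ?_
  -- a relation, in degree `(k, m)`, at a point `(τ, z)`
  have hrel (k : ℤ) (m : ℕ) (τ : ℍ) (z : Fin 2 → ℂ) : ∑ α ∈ p.support,
      (if α 0 + α 1 + α 2 = m then p.coeff α (k - (-2 * α 1 - 4 * α 2)) τ *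
        (genZero ^ α 0 * genNeg2 ^ α 1 * genNeg4 ^ α 2) τ z else 0) = 0 := by
    have h1 := congrArg (fun x : JacobiRing twoA1 ↦
      (x (k, m) : ℍ → (Fin 2 → ℂ) → ℂ) τ z) hp
    rw [MvPolynomial.aeval_def, MvPolynomial.eval₂_eq'] at h1
    simp only [DirectSum.sum_apply, AddSubmonoidClass.coe_finsetSum, Finset.sum_apply] at h1
    refine Eq.trans (Finset.sum_congr rfl fun α _ ↦ ?_) h1
    obtain ⟨h, hα⟩ := prod_generators α
    rw [hα]
    exact (modularFormHom_mul_of_apply (p.coeff α) ⟨_, h⟩ k m τ z).symm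
  ext β w τ
  set m := β 0 + β 1 + β 2 with hm
  set k := w + (-2 * β 1 - 4 * β 2) with hk
  let P : MvPolynomial (Fin 3) ℂ := ∑ α ∈ p.support with α 0 + α 1 + α 2 = m,
    MvPolynomial.monomial α (p.coeff α (k - (-2 * α 1 - 4 * α 2)) τ)
  have hP : P.IsHomogeneous m := by
    refine MvPolynomial.IsHomogeneous.sum _ _ _ fun α hα ↦ MvPolynomial.isHomogeneous_monomial _ ?_
    rw [Finsupp.degree_eq_sum, Fin.sum_univ_three]
    exact (Finset.mem_filter.mp hα).2
  have heval (z : Fin 2 → ℂ) :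
      MvPolynomial.eval ![genZero τ z, genNeg2 τ z, genNeg4 τ z] P = 0 := by
    rw [← hrel k m τ z, map_sum, Finset.sum_filter]
    refine Finset.sum_congr rfl fun α _ ↦ ?_
    rw [MvPolynomial.eval_monomial, Finsupp.prod_fintype _ _ (by simp), Fin.prod_univ_three]
    rfl
  have hP0 : P = 0 := by
    refine eq_zero_of_isHomogeneous hP (infinite_ratio τ) ?_
    rintro _ ⟨z, hz, rfl⟩ _ ⟨z', hz', rfl⟩
    have hz0 : phiZero τ z ≠ 0 := hz
    have hz0' : phiZero τ z' ≠ 0 := hz'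
    have e : ![genZero τ ![z, z'], genNeg2 τ ![z, z'], genNeg4 τ ![z, z']] =
        (phiZero τ z * phiZero τ z') • ![1,
          phiNeg2 τ z / phiZero τ z + phiNeg2 τ z' / phiZero τ z',
          phiNeg2 τ z / phiZero τ z * (phiNeg2 τ z' / phiZero τ z')] := by
      funext i
      fin_cases i
      · simp [genZero]
      · simp [genNeg2]
        field_simp
      · simp [genNeg4]
        field_simp
    have h := heval ![z, z']
    rw [e, eval_smul_of_isHomogeneous hP] at h
    exact (mul_eq_zero.mp h).resolve_left (pow_ne_zero _ (mul_ne_zero hz0 hz0'))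
  have hβ : P.coeff β = p.coeff β w τ := by
    have e : k - (-2 * β 1 - 4 * β 2) = w := by rw [hk]; ring
    simp only [P, MvPolynomial.coeff_sum, MvPolynomial.coeff_monomial, Finset.sum_ite_eq',
      Finset.mem_filter, hm, and_true]
    split_ifs with h
    · rw [e]
    · rw [MvPolynomial.notMem_support_iff.mp h]
      rfl
  rw [← hβ, hP0]
  rfl

end WeakJacobi

end

theorem proposition2 :
    ∃ (h0 : WeakJacobi.genZero ∈ WeakJacobi.jacobiForms WeakJacobi.twoA1 (0, 1))
      (h2 : WeakJacobi.genNeg2 ∈ WeakJacobi.jacobiForms WeakJacobi.twoA1 (-2, 1))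
      (h4 : WeakJacobi.genNeg4 ∈ WeakJacobi.jacobiForms WeakJacobi.twoA1 (-4, 1)),
      AlgebraicIndependent WeakJacobi.ModularFormRing (WeakJacobi.generators h0 h2 h4) ∧
        Algebra.adjoin WeakJacobi.ModularFormRing
          (Set.range (WeakJacobi.generators h0 h2 h4)) = ⊤ := by
  exact ⟨WeakJacobi.genZero_mem, WeakJacobi.genNeg2_mem, WeakJacobi.genNeg4_mem,
    WeakJacobi.algebraicIndependent_generators, WeakJacobi.generatedSubalgebra_eq_top⟩
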